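/- **Syntax.** Let $\mathcal V$ be a set of process variables with $ar\colon\mathcal V\to\mathbb N$, and let $a_1,a_2,\dots$ be names. Processes are $P::=P|P\mid \nu a_i(P)\mid f\mid P\sigma$, with $f\in\mathcal V$ and $\sigma$ a finitely supported permutation of the names; the degree of $\sigma$ is the greatest $i$ with $\sigma(a_i)\ne a_i$ ($0$ if there is none). Alphabets: $al(P|Q)=al(P)\cup al(Q)$, $al(\nu a_i(P))=al(P)\setminus\{a_i\}$, $al(f)=\{a_1,\dots,a_{ar(f)}\}$, $al(P\sigma)=\sigma^{-1}[al(P)]$. The judgement $n\vdash P$ is generated by: $n\vdash P$ and $n\vdash Q$ give $n\vdash P|Q$; $n+1\vdash P$ gives $n\vdash\nu a_{n+1}(P)$; $ar(f)\vdash f$; $n\vdash P$ and $degree(\sigma)\le n$ give $n\vdash P\sigma$; $n\vdash P$ gives $n+1\vdash P$. **Processes as diagrams.** A CW prop is a prop with arrows $\delta\colon1\to2$, $\epsilon\colon1\to0$, $\mu\colon2\to1$, $\eta\colon0\to1$ forming a commutative special Frobenius bimonoid. Let $\mathcal S_{CW}(\Sigma)$ be the free CW prop on one generator $f\colon ar(f)\to0$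 for each $f\in\mathcal V$. A derivation of $n\vdash P$ is translated to an arrow $\langle\langle P\rangle\rangle\colon n\to0$ by $\langle\langle P|Q\rangle\rangle=\delta_n;(\langle\langle P\rangle\rangle\oplus\langle\langle Q\rangle\rangle)$, $\langle\langle \nu a_{n+1}(P)\rangle\rangle=(id_n\oplus\eta);\langle\langle P\rangle\rangle$, $\langle\langle f\rangle\rangle=f$, $\langle\langle P\sigma\rangle\rangle=\overline\sigma;\langle\langle P\rangle\rangle$, $\langle\langle n+1\vdash P\rangle\rangle=\langle\langle n\vdash P\rangle\rangle\oplus\epsilon$. Here $\delta_n\colon n\to n+n$ joins wire $i$ to wires $i$ and $n+i$, and $\overline\sigma\colon n\to n$ joins wire $i$ on the left to wire $j$ on the right when $\sigma(a_i)=a_j$. **Process semantics.** Actions are functions $\alpha$ from names to $M$, where $M=2=\{0,1\}$ for Hoare (so actions are sets of names) and $M=\mathbb Z$ for Milner; $al(\alpha)$ is the support of $\alpha$, and for $al(\alpha)\subseteq\{a_1,\dots,a_n\}$ we write $n\vdash\alpha$ for its restriction to $\{a_1,\dots,a_n\}$, read as a word of length $n$. For each kind of action, every $f$ has a declaration $f:=\sum_{i\in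 I}\alpha_i.P_i$ with $I$ finite, $al(\alpha_i)\subseteq\{a_1,\dots,a_{ar(f)}\}$, $ar(f)\vdash P_i$ and $\{a_1,\dots,a_{ar(f)}\}\subseteq\bigcup_i al(\alpha_i)\cup\bigcup_i al(P_i)$. The common rules are $f\xrightarrow{0}f$; $f\xrightarrow{\alpha_i}P_i$; and $P\xrightarrow{\alpha}P'$ implies $P\sigma\xrightarrow{\alpha\circ\sigma}P'\sigma$. * $\to_H$ has in addition: $P\xrightarrow{\alpha}P'$, $Q\xrightarrow{\beta}Q'$ and $\alpha\cap al(Q)=\beta\cap al(P)$ imply $P|Q\xrightarrow{\alpha\cup\beta}P'|Q'$; $P\xrightarrow{\alpha}P'$ implies $\nu a_i(P)\xrightarrow{\alpha\setminus\{a_i\}}\nu a_i(P')$. * $\to_M$ has in addition: $P\xrightarrow{\alpha}P'$ and $Q\xrightarrow{\beta}Q'$ imply $P|Q\xrightarrow{\alpha+\beta}P'|Q'$; $P\xrightarrow{\alpha}P'$ and $\alpha(a_i)=0$ imply $\nu a_i(P)\xrightarrow{\alpha}\nu a_i(P')$. **Diagram semantics.** A transition $c\xrightarrow[\,v\,]{\,u\,}d$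 of $c\colon n\to m$ has $d\colon n\to m$, a left word $u\in M^n$ and a right word $v\in M^m$; write $\bullet$ for the empty word. Transitions are given on generators by $f\xrightarrow[\bullet]{ar(f)\vdash\alpha_i}\langle\langle P_i\rangle\rangle$ and $f\xrightarrow[\bullet]{ar(f)\vdash0}f$, and extended to all arrows of $\mathcal S_{CW}(\Sigma)$ by the distributive law, that is, by the following rules, which respect the equations of CW props: if $c\xrightarrow[v]{u}c'$ and $d\xrightarrow[w]{v}d'$ then $c;d\xrightarrow[w]{u}c';d'$; if $c\xrightarrow[v]{u}c'$ and $d\xrightarrow[v']{u'}d'$ then $c\oplus d\xrightarrow[vv']{uu'}c'\oplus d'$; $id_0$, $id_1$, the symmetry $1+1\to1+1$, $\delta,\epsilon,\mu,\eta$ have transitions only to themselves, with left/right words $\bullet/\bullet$, $k/k$, $kl/lk$ for $id_0$, $id_1$, the symmetry, and * in the black law $\to_b$ ($M=2$): $\delta\colon k/kk$, $\epsilon\colon k/\bullet$, $\mu\colon kk/k$, $\eta\colon\bullet/k$; * in the white law $\to_w$ ($M=\mathbb Z$): $\delta\colon k+l/kl$, $\epsilon\colon 0/\bullet$, $\mu\colon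 kl/k+l$, $\eta\colon\bullet/0$ ($k,l\in M$ arbitrary). **Theorem.** Let $n\vdash P$, and let $\alpha$ be an action with $al(\alpha)\subseteq al(P)$ (hence $n\vdash\alpha$ is defined). * *Hoare is black* ($M=2$). If $P\xrightarrow{\alpha}_H P'$, then $n\vdash P'$ and $\langle\langle P\rangle\rangle\xrightarrow[\bullet]{n\vdash\alpha}_b\langle\langle P'\rangle\rangle$. Conversely, if $\langle\langle P\rangle\rangle\xrightarrow[\bullet]{n\vdash\alpha}_b d$, then there is $n\vdash P'$ with $P\xrightarrow{\alpha}_H P'$ and $\langle\langle P'\rangle\rangle=d$. * *Milner is white* ($M=\mathbb Z$). If $P\xrightarrow{\alpha}_M P'$, then $n\vdash P'$ and $\langle\langle P\rangle\rangle\xrightarrow[\bullet]{n\vdash\alpha}_w\langle\langle P'\rangle\rangle$. Conversely, if $\langle\langle P\rangle\rangle\xrightarrow[\bullet]{n\vdash\alpha}_w d$, then there is $n\vdash P'$ with $P\xrightarrow{\alpha}_M P'$ and $\langle\langle P'\rangle\rangle=d$. The forward implications hold for every derivation of $n\vdash P$ and of $n\vdash P'$. -/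

import Mathlib

universe u v

/-! ## Props and Carboni-Walters props -/

/-- Transport of an element of an `ℕ × ℕ`-indexed family along equalities of the indices. -/
def castH {X : ℕ → ℕ → Type u} {n n' m m' : ℕ} (h : n = n') (h' : m = m') (x : X n m) : X n' m' :=
  h ▸ h' ▸ x

/-- The operations of a CW prop on a signature `X` (an `ℕ × ℕ`-indexed family of sets): the
operations of a prop together with the four constants of a Frobenius structure. -/
class CWOps (X : ℕ → ℕ → Type u) where
  id0 : X 0 0
  id1 : X 1 1
  sym : X 2 2
  seq : ∀ {n m k : ℕ}, X n m → X m k → X n k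
  par : ∀ {n m n' m' : ℕ}, X n m → X n' m' → X (n + n') (m + m')
  comul : X 1 2
  counit : X 1 0
  mul : X 2 1
  unit : X 0 1

namespace CWOps

variable {X : ℕ → ℕ → Type u} [CWOps X]

/-- The identity on `n`: the parallel composition of `n` copies of the identity on `1`. -/
def idn : (n : ℕ) → X n n
  | 0 => id0
  | n + 1 => par (idn n) id1

/-- The symmetry that moves one wire past `n` wires. -/
def symOneN : (n : ℕ) → X (1 + n) (n + 1)
  | 0 => (id1 : X 1 1)
  | n + 1 => (seq (par (symOneN n) id1 : X (1 + n + 1) (n + 1 + 1))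
      (par (idn n) sym : X (n + 2) (n + 2)) : X (1 + n + 1) (n + 2))

/-- The symmetry that moves `n` wires past one wire. -/
def symNOne : (n : ℕ) → X (n + 1) (1 + n)
  | 0 => (id1 : X 1 1)
  | n + 1 => (seq (par (idn n) sym : X (n + 2) (n + 2))
      (par (symNOne n) id1 : X (n + 1 + 1) (1 + n + 1)) : X (n + 2) (1 + n + 1))

end CWOps

open CWOps in
/-- The defining equations of CW props: those of strict symmetric monoidal categories with
`ℕ` (under addition) as objects, and those of (commutative) special Frobenius bimonoids. -/
inductive CWEq {X : ℕ → ℕ → Type u} [CWOps X] : ∀ {n m : ℕ}, X n m → X n m → Prop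
  | par_assoc {n₁ m₁ n₂ m₂ n₃ m₃ : ℕ} (f : X n₁ m₁) (g : X n₂ m₂) (h : X n₃ m₃) :
      CWEq (par (par f g) h)
        (castH (Nat.add_assoc n₁ n₂ n₃).symm (Nat.add_assoc m₁ m₂ m₃).symm (par f (par g h)))
  | id0_par {n m : ℕ} (f : X n m) :
      CWEq (castH (Nat.zero_add n) (Nat.zero_add m) (par id0 f)) f
  | par_id0 {n m : ℕ} (f : X n m) : CWEq (par f id0) f
  | sym_sym : CWEq (seq sym sym) (idn 2 : X 2 2)
  | interchange {n₁ m₁ k₁ n₂ m₂ k₂ : ℕ} (f : X n₁ m₁) (g : X m₁ k₁) (h : X n₂ m₂) (i : X m₂ k₂) :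
      CWEq (par (seq f g) (seq h i)) (seq (par f h) (par g i))
  | seq_assoc {n m k l : ℕ} (f : X n m) (g : X m k) (h : X k l) :
      CWEq (seq (seq f g) h) (seq f (seq g h))
  | seq_id {n m : ℕ} (f : X n m) : CWEq (seq f (idn m)) f
  | id_seq {n m : ℕ} (f : X n m) : CWEq (seq (idn n) f) f
  | symOneN_nat {n m : ℕ} (f : X n m) :
      CWEq (seq (symOneN n) (par f id1)) (seq (par id1 f) (symOneN m))
  | symNOne_nat {n m : ℕ} (f : X n m) :
      CWEq (seq (symNOne n) (par id1 f)) (seq (par f id1) (symNOne m))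
  | comul_assoc :
      CWEq (seq comul (par comul id1 : X 2 3)) (seq comul (par id1 comul : X 2 3))
  | comul_comm : CWEq (seq comul sym) (comul : X 1 2)
  | counit_comul : CWEq (seq comul (par counit id1 : X 2 1)) (id1 : X 1 1)
  | mul_assoc : CWEq (seq (par mul id1 : X 3 2) mul) (seq (par id1 mul : X 3 2) mul)
  | mul_comm : CWEq (seq sym mul) (mul : X 2 1)
  | unit_mul : CWEq (seq (par unit id1 : X 1 2) mul) (id1 : X 1 1)
  | special : CWEq (seq comul mul) (id1 : X 1 1)
  | frobenius_left :
      CWEq (seq (par comul id1 : X 2 3) (par id1 mul : X 3 2)) (seq mul comul : X 2 2)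
  | frobenius_right :
      CWEq (seq (par id1 comul : X 2 3) (par mul id1 : X 3 2)) (seq mul comul : X 2 2)

/-- A CW prop, presented by its family of hom-sets. -/
class CWProp (X : ℕ → ℕ → Type u) extends CWOps X where
  eq_of_cwEq : ∀ {n m : ℕ} {x y : X n m}, CWEq x y → x = y

/-- `F` commutes with all the operations of CW props. -/
structure IsCWHom {X : ℕ → ℕ → Type u} {Y : ℕ → ℕ → Type v} [CWOps X] [CWOps Y]
    (F : ∀ n m : ℕ, X n m → Y n m) : Prop where
  id0 : F 0 0 CWOps.id0 = CWOps.id0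
  id1 : F 1 1 CWOps.id1 = CWOps.id1
  sym : F 2 2 CWOps.sym = CWOps.sym
  seq : ∀ {n m k : ℕ} (f : X n m) (g : X m k),
    F n k (CWOps.seq f g) = CWOps.seq (F n m f) (F m k g)
  par : ∀ {n m n' m' : ℕ} (f : X n m) (g : X n' m'),
    F (n + n') (m + m') (CWOps.par f g) = CWOps.par (F n m f) (F n' m' g)
  comul : F 1 2 CWOps.comul = CWOps.comul
  counit : F 1 0 CWOps.counit = CWOps.counit
  mul : F 2 1 CWOps.mul = CWOps.mul
  unit : F 0 1 CWOps.unit = CWOps.unit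

theorem map_castH {X : ℕ → ℕ → Type u} {Y : ℕ → ℕ → Type v} (F : ∀ n m : ℕ, X n m → Y n m)
    {n n' m m' : ℕ} (h : n = n') (h' : m = m') (x : X n m) :
    F n' m' (castH h h' x) = castH h h' (F n m x) := by
  subst h h'; rfl

namespace IsCWHom

variable {X : ℕ → ℕ → Type u} {Y : ℕ → ℕ → Type v} [CWOps X] [CWOps Y]
  {F : ∀ n m : ℕ, X n m → Y n m}

theorem idn (hF : IsCWHom F) (n : ℕ) : F n n (CWOps.idn n) = CWOps.idn n := by
  induction n with
  | zero => exact hF.id0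
  | succ n ih => exact (hF.par _ _).trans (congrArg₂ CWOps.par ih hF.id1)

theorem symOneN (hF : IsCWHom F) (n : ℕ) :
    F (1 + n) (n + 1) (CWOps.symOneN n) = CWOps.symOneN n := by
  induction n with
  | zero => exact hF.id1
  | succ n ih =>
    exact (hF.seq _ _).trans (congrArg₂ CWOps.seq
      ((hF.par _ _).trans (congrArg₂ CWOps.par ih hF.id1))
      ((hF.par _ _).trans (congrArg₂ CWOps.par (hF.idn n) hF.sym)))

theorem symNOne (hF : IsCWHom F) (n : ℕ) :
    F (n + 1) (1 + n) (CWOps.symNOne n) = CWOps.symNOne n := by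
  induction n with
  | zero => exact hF.id1
  | succ n ih =>
    exact (hF.seq _ _).trans (congrArg₂ CWOps.seq
      ((hF.par _ _).trans (congrArg₂ CWOps.par (hF.idn n) hF.sym))
      ((hF.par _ _).trans (congrArg₂ CWOps.par ih hF.id1)))

/-- Homomorphisms preserve the defining equations. -/
theorem map_cwEq (hF : IsCWHom F) {n m : ℕ} {x y : X n m} (h : CWEq x y) :
    CWEq (F n m x) (F n m y) := by
  cases h with
  | par_assoc f g h =>
    rw [map_castH F, hF.par, hF.par, hF.par, hF.par]; exact .par_assoc _ _ _
  | id0_par => rw [map_castH F, hF.par, hF.id0]; exact .id0_par _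
  | par_id0 f =>
    have e := hF.par f CWOps.id0
    rw [hF.id0] at e
    exact e ▸ CWEq.par_id0 _
  | sym_sym => rw [hF.seq, hF.sym, hF.idn]; exact .sym_sym
  | interchange f g h i =>
    simp only [hF.par, hF.seq]; exact .interchange _ _ _ _
  | seq_assoc f g h => simp only [hF.seq]; exact .seq_assoc _ _ _
  | seq_id => rw [hF.seq, hF.idn]; exact .seq_id _
  | id_seq => rw [hF.seq, hF.idn]; exact .id_seq _
  | symOneN_nat f =>
    simp only [hF.seq, hF.par, hF.symOneN, hF.id1]; exact .symOneN_nat _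
  | symNOne_nat f =>
    simp only [hF.seq, hF.par, hF.symNOne, hF.id1]; exact .symNOne_nat _
  | comul_assoc =>
    have e := hF.par CWOps.comul CWOps.id1
    have e' := hF.par CWOps.id1 CWOps.comul
    rw [hF.comul, hF.id1] at e e'
    rw [hF.seq, hF.seq, hF.comul]
    exact (e ▸ e' ▸ CWEq.comul_assoc)
  | comul_comm => rw [hF.seq, hF.comul, hF.sym]; exact .comul_comm
  | counit_comul =>
    have e := hF.par CWOps.counit CWOps.id1
    rw [hF.counit, hF.id1] at e
    rw [hF.seq, hF.comul, hF.id1]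
    exact (e ▸ CWEq.counit_comul)
  | mul_assoc =>
    have e := hF.par CWOps.mul CWOps.id1
    have e' := hF.par CWOps.id1 CWOps.mul
    rw [hF.mul, hF.id1] at e e'
    rw [hF.seq, hF.seq, hF.mul]
    exact (e ▸ e' ▸ CWEq.mul_assoc)
  | mul_comm => rw [hF.seq, hF.mul, hF.sym]; exact .mul_comm
  | unit_mul =>
    have e := hF.par CWOps.unit CWOps.id1
    rw [hF.unit, hF.id1] at e
    rw [hF.seq, hF.mul, hF.id1]
    exact (e ▸ CWEq.unit_mul)
  | special => rw [hF.seq, hF.comul, hF.mul, hF.id1]; exact .special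
  | frobenius_left =>
    have e := hF.par CWOps.comul CWOps.id1
    have e' := hF.par CWOps.id1 CWOps.mul
    rw [hF.comul, hF.id1] at e
    rw [hF.mul, hF.id1] at e'
    rw [hF.seq, hF.seq, hF.comul, hF.mul]
    exact (e ▸ e' ▸ CWEq.frobenius_left)
  | frobenius_right =>
    have e := hF.par CWOps.mul CWOps.id1
    have e' := hF.par CWOps.id1 CWOps.comul
    rw [hF.comul, hF.id1] at e'
    rw [hF.mul, hF.id1] at e
    rw [hF.seq, hF.seq, hF.comul, hF.mul]
    exact (e' ▸ e ▸ CWEq.frobenius_right)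

end IsCWHom

/-! ## The free CW prop on a signature -/

/-- Sorted terms over the signature `S`. -/
inductive Term (S : ℕ → ℕ → Type u) : ℕ → ℕ → Type u
  | gen {n m : ℕ} (s : S n m) : Term S n m
  | id0 : Term S 0 0
  | id1 : Term S 1 1
  | sym : Term S 2 2
  | seq {n m k : ℕ} (f : Term S n m) (g : Term S m k) : Term S n k
  | par {n m n' m' : ℕ} (f : Term S n m) (g : Term S n' m') : Term S (n + n') (m + m')
  | comul : Term S 1 2
  | counit : Term S 1 0
  | mul : Term S 2 1
  | unit : Term S 0 1

instance (S : ℕ → ℕ → Type u) : CWOps (Term S) where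
  id0 := .id0
  id1 := .id1
  sym := .sym
  seq := .seq
  par := .par
  comul := .comul
  counit := .counit
  mul := .mul
  unit := .unit

/-- Structural congruence: the smallest congruence on terms that contains the equations of
CW props. -/
inductive Term.Cong {S : ℕ → ℕ → Type u} : ∀ {n m : ℕ}, Term S n m → Term S n m → Prop
  | of_cwEq {n m : ℕ} {s t : Term S n m} : CWEq s t → Term.Cong s t
  | refl {n m : ℕ} (t : Term S n m) : Term.Cong t t
  | symm {n m : ℕ} {s t : Term S n m} : Term.Cong s t → Term.Cong t s
  | trans {n m : ℕ} {r s t : Term S n m} : Term.Cong r s → Term.Cong s t → Term.Cong r t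
  | seq {n m k : ℕ} {f f' : Term S n m} {g g' : Term S m k} :
      Term.Cong f f' → Term.Cong g g' → Term.Cong (Term.seq f g) (Term.seq f' g')
  | par {n m n' m' : ℕ} {f f' : Term S n m} {g g' : Term S n' m'} :
      Term.Cong f f' → Term.Cong g g' → Term.Cong (Term.par f g) (Term.par f' g')

instance Term.setoid (S : ℕ → ℕ → Type u) (n m : ℕ) : Setoid (Term S n m) where
  r := Term.Cong
  iseqv := ⟨.refl, .symm, .trans⟩

/-- The free CW prop on `S`: its arrows `n → m` are string diagrams, that is, terms of sort
`(n, m)` modulo structural congruence. -/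
def FreeCW (S : ℕ → ℕ → Type u) (n m : ℕ) : Type u := Quotient (Term.setoid S n m)

namespace FreeCW

variable {S : ℕ → ℕ → Type u}

/-- The diagram of a term. -/
def mk {n m : ℕ} (t : Term S n m) : FreeCW S n m := Quotient.mk _ t

/-- The inclusion of the generators. -/
def gen {n m : ℕ} (s : S n m) : FreeCW S n m := mk (.gen s)

instance : CWOps (FreeCW S) where
  id0 := mk .id0
  id1 := mk .id1
  sym := mk .sym
  seq := Quotient.map₂ Term.seq fun _ _ h _ _ h' => Term.Cong.seq h h'
  par := Quotient.map₂ Term.par fun _ _ h _ _ h' => Term.Cong.par h h'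
  comul := mk .comul
  counit := mk .counit
  mul := mk .mul
  unit := mk .unit

theorem mk_isCWHom : IsCWHom (X := Term S) (Y := FreeCW S) (fun _ _ t => mk t) where
  id0 := rfl
  id1 := rfl
  sym := rfl
  seq _ _ := rfl
  par _ _ := rfl
  comul := rfl
  counit := rfl
  mul := rfl
  unit := rfl

theorem mk_eq_of_cwEq {n m : ℕ} {s t : Term S n m} (h : CWEq s t) : mk s = mk t :=
  Quotient.sound (Term.Cong.of_cwEq h)

theorem exists_rep {n m : ℕ} (c : FreeCW S n m) : ∃ t, mk t = c := Quotient.exists_rep c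

instance : CWProp (FreeCW S) where
  eq_of_cwEq := by
    have H := mk_isCWHom (S := S)
    intro n m x y h
    cases h with
    | par_assoc f g h =>
      obtain ⟨f, rfl⟩ := exists_rep f
      obtain ⟨g, rfl⟩ := exists_rep g
      obtain ⟨h, rfl⟩ := exists_rep h
      exact (mk_eq_of_cwEq (CWEq.par_assoc f g h)).trans
        (map_castH (Y := FreeCW S) (fun _ _ t => mk t) _ _ _)
    | id0_par =>
      obtain ⟨f, rfl⟩ := exists_rep y
      exact (map_castH (Y := FreeCW S) (fun _ _ t => mk t) _ _ _).symm.trans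
        (mk_eq_of_cwEq (CWEq.id0_par f))
    | par_id0 f =>
      obtain ⟨f, rfl⟩ := exists_rep f
      exact mk_eq_of_cwEq (CWEq.par_id0 f)
    | sym_sym => rw [← H.idn]; exact mk_eq_of_cwEq CWEq.sym_sym
    | interchange f g h i =>
      obtain ⟨f, rfl⟩ := exists_rep f
      obtain ⟨g, rfl⟩ := exists_rep g
      obtain ⟨h, rfl⟩ := exists_rep h
      obtain ⟨i, rfl⟩ := exists_rep i
      exact mk_eq_of_cwEq (CWEq.interchange f g h i)
    | seq_assoc f g h =>
      obtain ⟨f, rfl⟩ := exists_rep f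
      obtain ⟨g, rfl⟩ := exists_rep g
      obtain ⟨h, rfl⟩ := exists_rep h
      exact mk_eq_of_cwEq (CWEq.seq_assoc f g h)
    | seq_id =>
      obtain ⟨f, rfl⟩ := exists_rep y
      rw [← H.idn]; exact mk_eq_of_cwEq (CWEq.seq_id f)
    | id_seq =>
      obtain ⟨f, rfl⟩ := exists_rep y
      rw [← H.idn]; exact mk_eq_of_cwEq (CWEq.id_seq f)
    | symOneN_nat f =>
      obtain ⟨f, rfl⟩ := exists_rep f
      rw [← H.symOneN, ← H.symOneN]; exact mk_eq_of_cwEq (CWEq.symOneN_nat f)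
    | symNOne_nat f =>
      obtain ⟨f, rfl⟩ := exists_rep f
      rw [← H.symNOne, ← H.symNOne]; exact mk_eq_of_cwEq (CWEq.symNOne_nat f)
    | comul_assoc => exact mk_eq_of_cwEq CWEq.comul_assoc
    | comul_comm => exact mk_eq_of_cwEq CWEq.comul_comm
    | counit_comul => exact mk_eq_of_cwEq CWEq.counit_comul
    | mul_assoc => exact mk_eq_of_cwEq CWEq.mul_assoc
    | mul_comm => exact mk_eq_of_cwEq CWEq.mul_comm
    | unit_mul => exact mk_eq_of_cwEq CWEq.unit_mul
    | special => exact mk_eq_of_cwEq CWEq.special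
    | frobenius_left => exact mk_eq_of_cwEq CWEq.frobenius_left
    | frobenius_right => exact mk_eq_of_cwEq CWEq.frobenius_right

end FreeCW

/-- The interpretation of terms in a CW prop that extends an interpretation of the generators. -/
def Term.eval {S : ℕ → ℕ → Type u} {Y : ℕ → ℕ → Type v} [CWOps Y]
    (φ : ∀ n m : ℕ, S n m → Y n m) : ∀ {n m : ℕ}, Term S n m → Y n m
  | _, _, .gen s => φ _ _ s
  | _, _, .id0 => CWOps.id0
  | _, _, .id1 => CWOps.id1
  | _, _, .sym => CWOps.sym
  | _, _, .seq f g => CWOps.seq (f.eval φ) (g.eval φ)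
  | _, _, .par f g => CWOps.par (f.eval φ) (g.eval φ)
  | _, _, .comul => CWOps.comul
  | _, _, .counit => CWOps.counit
  | _, _, .mul => CWOps.mul
  | _, _, .unit => CWOps.unit

theorem Term.eval_isCWHom {S : ℕ → ℕ → Type u} {Y : ℕ → ℕ → Type v} [CWOps Y]
    (φ : ∀ n m : ℕ, S n m → Y n m) :
    IsCWHom (X := Term S) (Y := Y) (fun _ _ t => t.eval φ) where
  id0 := rfl
  id1 := rfl
  sym := rfl
  seq _ _ := rfl
  par _ _ := rfl
  comul := rfl
  counit := rfl
  mul := rfl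
  unit := rfl

theorem Term.eval_eq_of_cong {S : ℕ → ℕ → Type u} {Y : ℕ → ℕ → Type v} [CWProp Y]
    (φ : ∀ n m : ℕ, S n m → Y n m) {n m : ℕ} {s t : Term S n m} (h : Term.Cong s t) :
    s.eval φ = t.eval φ := by
  induction h with
  | of_cwEq h => exact CWProp.eq_of_cwEq ((Term.eval_isCWHom φ).map_cwEq h)
  | refl t => rfl
  | symm _ ih => exact ih.symm
  | trans _ _ ih ih' => exact ih.trans ih'
  | seq _ _ ih ih' => exact congrArg₂ CWOps.seq ih ih'
  | par _ _ ih ih' => exact congrArg₂ CWOps.par ih ih'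

namespace FreeCW

variable {S : ℕ → ℕ → Type u} {Y : ℕ → ℕ → Type v} [CWProp Y]

/-- The extension of an interpretation of the generators in a CW prop `Y` to a morphism of
CW props from the free CW prop to `Y`. -/
def lift (φ : ∀ n m : ℕ, S n m → Y n m) {n m : ℕ} (c : FreeCW S n m) : Y n m :=
  Quotient.lift (fun t => t.eval φ) (fun _ _ h => Term.eval_eq_of_cong φ h) c

theorem lift_gen (φ : ∀ n m : ℕ, S n m → Y n m) {n m : ℕ} (s : S n m) :
    lift φ (gen s) = φ n m s := rfl

theorem lift_isCWHom (φ : ∀ n m : ℕ, S n m → Y n m) :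
    IsCWHom (X := FreeCW S) (Y := Y) (fun _ _ c => lift φ c) where
  id0 := rfl
  id1 := rfl
  sym := rfl
  seq f g := by
    obtain ⟨f, rfl⟩ := exists_rep f
    obtain ⟨g, rfl⟩ := exists_rep g
    rfl
  par f g := by
    obtain ⟨f, rfl⟩ := exists_rep f
    obtain ⟨g, rfl⟩ := exists_rep g
    rfl
  comul := rfl
  counit := rfl
  mul := rfl
  unit := rfl

/-- `lift φ` is the only such extension. -/
theorem lift_unique (φ : ∀ n m : ℕ, S n m → Y n m) (F : ∀ n m : ℕ, FreeCW S n m → Y n m)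
    (hF : IsCWHom F) (hgen : ∀ {n m : ℕ} (s : S n m), F n m (gen s) = φ n m s)
    {n m : ℕ} (c : FreeCW S n m) : F n m c = lift φ c := by
  obtain ⟨t, rfl⟩ := exists_rep c
  induction t with
  | gen s => exact hgen s
  | id0 => exact hF.id0
  | id1 => exact hF.id1
  | sym => exact hF.sym
  | seq f g ihf ihg => exact (hF.seq _ _).trans (congrArg₂ CWOps.seq ihf ihg)
  | par f g ihf ihg => exact (hF.par _ _).trans (congrArg₂ CWOps.par ihf ihg)
  | comul => exact hF.comul
  | counit => exact hF.counit
  | mul => exact hF.mul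
  | unit => exact hF.unit

end FreeCW

/-! ## Behaviours and distributive laws -/

/-- A way for the Frobenius generators to act on labels in `A`: the label relations of the four
generators, subject to the relational form of the equations of special Frobenius bimonoids.
`mul k l x` says that the multiplication has a transition with left label `k l` and right
label `x`; `comul x k l` that the comultiplication has a transition with left label `x` and right
label `k l`; `unit x` and `counit x` that the unit and the counit have a transition whose only
letter is `x`. -/
structure FrobLaw (A : Type v) where
  mul : A → A → A → Prop
  unit : A → Prop
  comul : A → A → A → Prop
  counit : A → Prop
  comul_assoc : ∀ x k l m : A,
    (∃ y, comul x y m ∧ comul y k l) ↔ (∃ y, comul x k y ∧ comul y l m)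
  comul_comm : ∀ x k l : A, comul x k l ↔ comul x l k
  counit_comul : ∀ x k : A, (∃ y, comul x y k ∧ counit y) ↔ x = k
  mul_assoc : ∀ x k l m : A, (∃ y, mul k l y ∧ mul y m x) ↔ (∃ y, mul l m y ∧ mul k y x)
  mul_comm : ∀ x k l : A, mul k l x ↔ mul l k x
  unit_mul : ∀ x k : A, (∃ y, unit y ∧ mul y k x) ↔ k = x
  special : ∀ x y : A, (∃ k l, comul x k l ∧ mul k l y) ↔ x = y
  frobenius_left : ∀ x y k z : A,
    (∃ l, comul x k l ∧ mul l y z) ↔ (∃ w, mul x y w ∧ comul w k z)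
  frobenius_right : ∀ x y z l : A,
    (∃ k, comul y k l ∧ mul x k z) ↔ (∃ w, mul x y w ∧ comul w z l)

/-- The black law: all wires meeting at a node carry the same label. -/
def blackLaw (A : Type v) : FrobLaw A where
  mul k l x := k = x ∧ l = x
  unit _ := True
  comul x k l := k = x ∧ l = x
  counit _ := True
  comul_assoc := by grind
  comul_comm := by grind
  counit_comul := by grind
  mul_assoc := by grind
  mul_comm := by grind
  unit_mul := by grind
  special := by grind
  frobenius_left := by grind
  frobenius_right := by grind

/-- The white law, for labels in an abelian group: the labels on both sides of a node have the
same sum. -/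
def whiteLaw (A : Type v) [AddCommGroup A] : FrobLaw A where
  mul k l x := k + l = x
  unit x := x = 0
  comul x k l := k + l = x
  counit x := x = 0
  comul_assoc x k l m := by
    constructor
    · rintro ⟨y, rfl, rfl⟩; exact ⟨l + m, by abel, rfl⟩
    · rintro ⟨y, rfl, rfl⟩; exact ⟨k + l, by abel, rfl⟩
  comul_comm x k l := by rw [add_comm]
  counit_comul x k := by simp [eq_comm]
  mul_assoc x k l m := by simp [add_assoc]
  mul_comm x k l := by rw [add_comm]
  unit_mul x k := by simp
  special x y := ⟨by rintro ⟨k, l, rfl, rfl⟩; rfl, by rintro rfl; exact ⟨x, 0, by simp, by simp⟩⟩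
  frobenius_left x y k z := by
    constructor
    · rintro ⟨l, rfl, rfl⟩; exact ⟨_, rfl, by abel⟩
    · rintro ⟨w, rfl, h⟩
      exact ⟨x - k, by abel, by rw [eq_sub_of_add_eq' h]; abel⟩
  frobenius_right x y z l := by
    constructor
    · rintro ⟨k, rfl, rfl⟩; exact ⟨_, rfl, by abel⟩
    · rintro ⟨w, rfl, h⟩
      exact ⟨y - l, by abel, by rw [eq_sub_of_add_eq h]; abel⟩

/-- The behaviour functor: a behaviour of sort `(n, m)` is a set of transitions `(a, c, b)` with
left label the word `a` of length `n`, right label the word `b` of length `m`, and target the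
element `c` of sort `(n, m)`. The law `R` does not occur in the definition: it selects the CW prop
structure on behaviours that is defined below. -/
def Beh {A : Type v} (_R : FrobLaw A) (X : ℕ → ℕ → Type u) (n m : ℕ) : Type (max u v) :=
  Set ((Fin n → A) × X n m × (Fin m → A))

instance Beh.instMembership {A : Type v} (R : FrobLaw A) (X : ℕ → ℕ → Type u) (n m : ℕ) :
    Membership ((Fin n → A) × X n m × (Fin m → A)) (Beh R X n m) :=
  inferInstanceAs (Membership _ (Set ((Fin n → A) × X n m × (Fin m → A))))

/-- The rules for the operations of CW props. For every CW prop `X` this makes behaviours over `X`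
into a CW prop; this is the distributive law of the monad of CW props over the behaviour functor, in
the form of a lifting of that functor to the algebras of the monad. -/
instance Beh.cwOps {A : Type v} (R : FrobLaw A) (X : ℕ → ℕ → Type u) [CWOps X] :
    CWOps (Beh R X) where
  id0 := {x | x = (![], CWOps.id0, ![])}
  id1 := {x | ∃ k : A, x = (![k], CWOps.id1, ![k])}
  sym := {x | ∃ k l : A, x = (![k, l], CWOps.sym, ![l, k])}
  seq F G := {x | ∃ w c d, (x.1, c, w) ∈ F ∧ (w, d, x.2.2) ∈ G ∧ x.2.1 = CWOps.seq c d}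
  par F G := {x | ∃ a₁ c₁ b₁ a₂ c₂ b₂, (a₁, c₁, b₁) ∈ F ∧ (a₂, c₂, b₂) ∈ G ∧
    x = (Fin.append a₁ a₂, CWOps.par c₁ c₂, Fin.append b₁ b₂)}
  comul := {x | ∃ y k l, R.comul y k l ∧ x = (![y], CWOps.comul, ![k, l])}
  counit := {x | ∃ y, R.counit y ∧ x = (![y], CWOps.counit, ![])}
  mul := {x | ∃ k l y, R.mul k l y ∧ x = (![k, l], CWOps.mul, ![y])}
  unit := {x | ∃ y, R.unit y ∧ x = (![], CWOps.unit, ![y])}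

namespace Beh

section

variable {A : Type v} {R : FrobLaw A} {X : ℕ → ℕ → Type u}

/-- `F.Tr a c b`: the behaviour `F` has a transition to `c` with left label `a` and right
label `b`. -/
def Tr {n m : ℕ} (F : Beh R X n m) (a : Fin n → A) (c : X n m) (b : Fin m → A) : Prop :=
  (a, c, b) ∈ F

theorem ext_tr {n m : ℕ} {F G : Beh R X n m} (h : ∀ a c b, F.Tr a c b ↔ G.Tr a c b) : F = G :=
  Set.ext fun ⟨a, c, b⟩ => h a c b

theorem append_inj {n m : ℕ} {a a' : Fin n → A} {b b' : Fin m → A} :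
    Fin.append a b = Fin.append a' b' ↔ a = a' ∧ b = b' := by
  constructor
  · intro h
    refine ⟨funext fun i => ?_, funext fun i => ?_⟩
    · simpa using congrFun h (Fin.castAdd m i)
    · simpa using congrFun h (Fin.natAdd n i)
  · rintro ⟨rfl, rfl⟩; rfl

theorem append_one_one (k l : A) : Fin.append ![k] ![l] = ![k, l] := by
  funext i; fin_cases i <;> rfl

theorem append_two_one (k l m : A) : Fin.append ![k, l] ![m] = ![k, l, m] := by
  funext i; fin_cases i <;> rfl

theorem append_one_two (k l m : A) : Fin.append ![k] ![l, m] = ![k, l, m] := by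
  funext i; fin_cases i <;> rfl

theorem append_zero_one (k : A) (a : Fin 0 → A) : Fin.append a ![k] = ![k] := by
  funext i; fin_cases i; rfl

variable [CWOps X]

theorem id0_tr (a : Fin 0 → A) (c : X 0 0) (b : Fin 0 → A) :
    (CWOps.id0 : Beh R X 0 0).Tr a c b ↔ c = CWOps.id0 := by
  change (a, c, b) = (![], CWOps.id0, ![]) ↔ _
  simp [Prod.ext_iff, Subsingleton.elim a ![], Subsingleton.elim b ![]]

theorem id1_tr (a : Fin 1 → A) (c : X 1 1) (b : Fin 1 → A) :
    (CWOps.id1 : Beh R X 1 1).Tr a c b ↔ ∃ k, a = ![k] ∧ c = CWOps.id1 ∧ b = ![k] := by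
  change (∃ k : A, (a, c, b) = (![k], CWOps.id1, ![k])) ↔ _
  simp only [Prod.ext_iff]

theorem sym_tr (a : Fin 2 → A) (c : X 2 2) (b : Fin 2 → A) :
    (CWOps.sym : Beh R X 2 2).Tr a c b ↔
      ∃ k l, a = ![k, l] ∧ c = CWOps.sym ∧ b = ![l, k] := by
  change (∃ k l : A, (a, c, b) = (![k, l], CWOps.sym, ![l, k])) ↔ _
  simp only [Prod.ext_iff]

theorem comul_tr (a : Fin 1 → A) (c : X 1 2) (b : Fin 2 → A) :
    (CWOps.comul : Beh R X 1 2).Tr a c b ↔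
      ∃ y k l, R.comul y k l ∧ a = ![y] ∧ c = CWOps.comul ∧ b = ![k, l] := by
  change (∃ y k l, R.comul y k l ∧ (a, c, b) = (![y], CWOps.comul, ![k, l])) ↔ _
  simp only [Prod.ext_iff]

theorem counit_tr (a : Fin 1 → A) (c : X 1 0) (b : Fin 0 → A) :
    (CWOps.counit : Beh R X 1 0).Tr a c b ↔ ∃ y, R.counit y ∧ a = ![y] ∧ c = CWOps.counit := by
  change (∃ y, R.counit y ∧ (a, c, b) = (![y], CWOps.counit, ![])) ↔ _
  simp [Prod.ext_iff, Subsingleton.elim b ![]]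

theorem mul_tr (a : Fin 2 → A) (c : X 2 1) (b : Fin 1 → A) :
    (CWOps.mul : Beh R X 2 1).Tr a c b ↔
      ∃ k l y, R.mul k l y ∧ a = ![k, l] ∧ c = CWOps.mul ∧ b = ![y] := by
  change (∃ k l y, R.mul k l y ∧ (a, c, b) = (![k, l], CWOps.mul, ![y])) ↔ _
  simp only [Prod.ext_iff]

theorem unit_tr (a : Fin 0 → A) (c : X 0 1) (b : Fin 1 → A) :
    (CWOps.unit : Beh R X 0 1).Tr a c b ↔ ∃ y, R.unit y ∧ c = CWOps.unit ∧ b = ![y] := by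
  change (∃ y, R.unit y ∧ (a, c, b) = (![], CWOps.unit, ![y])) ↔ _
  simp [Prod.ext_iff, Subsingleton.elim a ![]]

theorem seq_tr {n m k : ℕ} (F : Beh R X n m) (G : Beh R X m k)
    (a : Fin n → A) (c : X n k) (b : Fin k → A) :
    (CWOps.seq F G).Tr a c b ↔
      ∃ w c₁ c₂, F.Tr a c₁ w ∧ G.Tr w c₂ b ∧ c = CWOps.seq c₁ c₂ := Iff.rfl

theorem par_tr {n m n' m' : ℕ} (F : Beh R X n m) (G : Beh R X n' m')
    (a : Fin (n + n') → A) (c : X (n + n') (m + m')) (b : Fin (m + m') → A) :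
    (CWOps.par F G).Tr a c b ↔
      ∃ a₁ c₁ b₁ a₂ c₂ b₂, F.Tr a₁ c₁ b₁ ∧ G.Tr a₂ c₂ b₂ ∧
        a = Fin.append a₁ a₂ ∧ c = CWOps.par c₁ c₂ ∧ b = Fin.append b₁ b₂ := by
  change (∃ a₁ c₁ b₁ a₂ c₂ b₂, F.Tr a₁ c₁ b₁ ∧ G.Tr a₂ c₂ b₂ ∧
    (a, c, b) = (Fin.append a₁ a₂, CWOps.par c₁ c₂, Fin.append b₁ b₂)) ↔ _
  simp only [Prod.ext_iff]

theorem exists_append_one {n : ℕ} (a : Fin (n + 1) → A) :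
    ∃ (a' : Fin n → A) (k : A), a = Fin.append a' ![k] := by
  refine ⟨fun i => a (Fin.castAdd 1 i), a (Fin.natAdd n 0), ?_⟩
  funext i
  refine Fin.addCases (fun i => ?_) (fun i => ?_) i
  · simp
  · fin_cases i; simp

theorem idn_tr (n : ℕ) (a : Fin n → A) (c : X n n) (b : Fin n → A) :
    (CWOps.idn n : Beh R X n n).Tr a c b ↔ c = CWOps.idn n ∧ a = b := by
  induction n with
  | zero =>
    refine (id0_tr a c b).trans ?_
    simp [Subsingleton.elim a b, CWOps.idn]
  | succ n ih =>
    refine (par_tr (CWOps.idn n : Beh R X n n) CWOps.id1 a c b).trans ?_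
    simp only [ih, id1_tr]
    constructor
    · rintro ⟨a₁, c₁, b₁, a₂, c₂, b₂, ⟨rfl, rfl⟩, ⟨k, rfl, rfl, rfl⟩, rfl, rfl, rfl⟩
      exact ⟨rfl, rfl⟩
    · rintro ⟨rfl, rfl⟩
      obtain ⟨a', k, rfl⟩ := exists_append_one a
      exact ⟨a', _, a', ![k], _, ![k], ⟨rfl, rfl⟩, ⟨k, rfl, rfl, rfl⟩, rfl, rfl, rfl⟩

theorem append_assoc_one {n : ℕ} (k l : A) (a : Fin n → A) :
    Fin.append (Fin.append ![k] a) ![l] = Fin.append ![k] (Fin.append a ![l]) := by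
  rw [Fin.append_assoc]; rfl

theorem append_assoc_one' {n : ℕ} (k l : A) (a : Fin n → A) :
    Fin.append (Fin.append a ![k]) ![l] = Fin.append a ![k, l] := by
  rw [Fin.append_assoc, append_one_one]; rfl

theorem symOneN_tr (n : ℕ) (a : Fin (1 + n) → A) (c : X (1 + n) (n + 1)) (b : Fin (n + 1) → A) :
    (CWOps.symOneN n : Beh R X (1 + n) (n + 1)).Tr a c b ↔
      ∃ k w, a = Fin.append ![k] w ∧ c = CWOps.symOneN n ∧ b = Fin.append w ![k] := by
  induction n with
  | zero =>
    refine (id1_tr a c b).trans (exists_congr fun k => ?_)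
    constructor
    · rintro ⟨rfl, rfl, rfl⟩
      exact ⟨![], by rw [Fin.append_right_nil _ _ rfl]; rfl, rfl,
        (append_zero_one k _).symm⟩
    · rintro ⟨w, rfl, rfl, rfl⟩
      exact ⟨by rw [Fin.append_right_nil _ _ rfl]; rfl, rfl, append_zero_one k _⟩
  | succ n ih =>
    refine (seq_tr (CWOps.par (CWOps.symOneN n) CWOps.id1 : Beh R X (1 + n + 1) (n + 1 + 1))
      (CWOps.par (CWOps.idn n) CWOps.sym : Beh R X (n + 2) (n + 2)) a c b).trans ?_
    constructor
    · rintro ⟨w, c₁, c₂, h₁, h₂, rfl⟩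
      obtain ⟨a₁, d₁, b₁, a₂, d₂, b₂, h, h', rfl, rfl, rfl⟩ := (par_tr _ _ _ _ _).1 h₁
      obtain ⟨k, v, rfl, rfl, rfl⟩ := (ih _ _ _).1 h
      obtain ⟨l, rfl, rfl, rfl⟩ := (id1_tr _ _ _).1 h'
      obtain ⟨a₁, d₁, b₁, a₂, d₂, b₂, h, h', e, rfl, rfl⟩ := (par_tr _ _ _ _ _).1 h₂
      obtain ⟨rfl, rfl⟩ := (idn_tr _ _ _ _).1 h
      obtain ⟨x, y, rfl, rfl, rfl⟩ := (sym_tr _ _ _).1 h'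
      have e' := (append_assoc_one' k l v).symm.trans e
      obtain ⟨rfl, e''⟩ := append_inj.1 e'
      have hx : k = x := congrFun e'' 0
      have hy : l = y := congrFun e'' 1
      subst hx hy
      exact ⟨k, Fin.append v ![l], append_assoc_one k l v, rfl, (append_assoc_one' l k v).symm⟩
    · rintro ⟨k, w, rfl, rfl, rfl⟩
      obtain ⟨v, l, rfl⟩ := exists_append_one w
      refine ⟨Fin.append (Fin.append v ![k]) ![l], _, _, (par_tr _ _ _ _ _).2
        ⟨Fin.append ![k] v, _, Fin.append v ![k], ![l], _, ![l], (ih _ _ _).2 ⟨k, v, rfl, rfl, rfl⟩,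
          (id1_tr _ _ _).2 ⟨l, rfl, rfl, rfl⟩, (append_assoc_one k l v).symm, rfl, rfl⟩,
        (par_tr _ _ _ _ _).2 ⟨v, _, v, ![k, l], _, ![l, k], (idn_tr _ _ _ _).2 ⟨rfl, rfl⟩,
          (sym_tr _ _ _).2 ⟨k, l, rfl, rfl, rfl⟩, append_assoc_one' k l v, rfl,
          append_assoc_one' l k v⟩, rfl⟩

theorem symNOne_tr (n : ℕ) (a : Fin (n + 1) → A) (c : X (n + 1) (1 + n)) (b : Fin (1 + n) → A) :
    (CWOps.symNOne n : Beh R X (n + 1) (1 + n)).Tr a c b ↔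
      ∃ k w, a = Fin.append w ![k] ∧ c = CWOps.symNOne n ∧ b = Fin.append ![k] w := by
  induction n with
  | zero =>
    refine (id1_tr a c b).trans (exists_congr fun k => ?_)
    constructor
    · rintro ⟨rfl, rfl, rfl⟩
      exact ⟨![], (append_zero_one k _).symm, rfl, by rw [Fin.append_right_nil _ _ rfl]; rfl⟩
    · rintro ⟨w, rfl, rfl, rfl⟩
      exact ⟨append_zero_one k _, rfl, by rw [Fin.append_right_nil _ _ rfl]; rfl⟩
  | succ n ih =>
    refine (seq_tr (CWOps.par (CWOps.idn n) CWOps.sym : Beh R X (n + 2) (n + 2))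
      (CWOps.par (CWOps.symNOne n) CWOps.id1 : Beh R X (n + 1 + 1) (1 + n + 1)) a c b).trans ?_
    constructor
    · rintro ⟨w, c₁, c₂, h₂, h₁, rfl⟩
      obtain ⟨a₁, d₁, b₁, a₂, d₂, b₂, h, h', rfl, rfl, rfl⟩ := (par_tr _ _ _ _ _).1 h₁
      obtain ⟨k, v, rfl, rfl, rfl⟩ := (ih _ _ _).1 h
      obtain ⟨l, rfl, rfl, rfl⟩ := (id1_tr _ _ _).1 h'
      obtain ⟨a₁, d₁, b₁, a₂, d₂, b₂, h, h', rfl, rfl, e⟩ := (par_tr _ _ _ _ _).1 h₂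
      obtain ⟨rfl, rfl⟩ := (idn_tr _ _ _ _).1 h
      obtain ⟨x, y, rfl, rfl, rfl⟩ := (sym_tr _ _ _).1 h'
      have e' := (append_assoc_one' k l v).symm.trans e
      obtain ⟨rfl, e''⟩ := append_inj.1 e'
      have hx : k = y := congrFun e'' 0
      have hy : l = x := congrFun e'' 1
      subst hx hy
      exact ⟨k, Fin.append v ![l], (append_assoc_one' l k v).symm, rfl, append_assoc_one k l v⟩
    · rintro ⟨k, w, rfl, rfl, rfl⟩
      obtain ⟨v, l, rfl⟩ := exists_append_one w
      refine ⟨(Fin.append (Fin.append v ![k]) ![l] : Fin (n + 1 + 1) → A), _, _,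
        (par_tr _ _ _ _ _).2 ⟨v, _, v, ![l, k], _, ![k, l], (idn_tr _ _ _ _).2 ⟨rfl, rfl⟩,
          (sym_tr _ _ _).2 ⟨l, k, rfl, rfl, rfl⟩, append_assoc_one' l k v, rfl,
          append_assoc_one' k l v⟩,
        (par_tr _ _ _ _ _).2
        ⟨Fin.append v ![k], _, Fin.append ![k] v, ![l], _, ![l], (ih _ _ _).2 ⟨k, v, rfl, rfl, rfl⟩,
          (id1_tr _ _ _).2 ⟨l, rfl, rfl, rfl⟩, rfl, rfl, (append_assoc_one k l v).symm⟩, rfl⟩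

end

end Beh

namespace Beh

variable {A : Type v} {R : FrobLaw A} {X : ℕ → ℕ → Type u}

theorem par_tr_castH [CWOps X] {n m n' m' p q : ℕ} (hp : n + n' = p) (hq : m + m' = q)
    (F : Beh R X n m) (G : Beh R X n' m') (a : Fin p → A) (c : X p q) (b : Fin q → A) :
    Tr (castH hp hq (CWOps.par F G) : Beh R X p q) a c b ↔
      ∃ a₁ c₁ b₁ a₂ c₂ b₂, F.Tr a₁ c₁ b₁ ∧ G.Tr a₂ c₂ b₂ ∧
        a = Fin.append a₁ a₂ ∘ Fin.cast hp.symm ∧ c = castH hp hq (CWOps.par c₁ c₂) ∧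
        b = Fin.append b₁ b₂ ∘ Fin.cast hq.symm := by
  subst hp hq; exact par_tr F G a c b

variable [CWProp X]

theorem par_assoc {n₁ m₁ n₂ m₂ n₃ m₃ : ℕ} (F : Beh R X n₁ m₁) (G : Beh R X n₂ m₂)
    (H : Beh R X n₃ m₃) :
    CWOps.par (CWOps.par F G) H =
      castH (Nat.add_assoc n₁ n₂ n₃).symm (Nat.add_assoc m₁ m₂ m₃).symm
        (CWOps.par F (CWOps.par G H)) := by
  refine ext_tr fun a c b => ?_
  rw [par_tr_castH]
  constructor
  · intro h
    obtain ⟨a₁, c₁, b₁, a₂, c₂, b₂, h₁, h₂, rfl, rfl, rfl⟩ := (par_tr _ _ _ _ _).1 h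
    obtain ⟨a₃, c₃, b₃, a₄, c₄, b₄, h₃, h₄, rfl, rfl, rfl⟩ := (par_tr _ _ _ _ _).1 h₁
    exact ⟨_, _, _, _, _, _, h₃, (par_tr _ _ _ _ _).2 ⟨_, _, _, _, _, _, h₄, h₂, rfl, rfl, rfl⟩,
      Fin.append_assoc _ _ _, CWProp.eq_of_cwEq (.par_assoc _ _ _), Fin.append_assoc _ _ _⟩
  · rintro ⟨a₁, c₁, b₁, a₂, c₂, b₂, h₁, h₂, rfl, rfl, rfl⟩
    obtain ⟨a₃, c₃, b₃, a₄, c₄, b₄, h₃, h₄, rfl, rfl, rfl⟩ := (par_tr _ _ _ _ _).1 h₂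
    exact (par_tr _ _ _ _ _).2 ⟨_, _, _, _, _, _,
      (par_tr _ _ _ _ _).2 ⟨_, _, _, _, _, _, h₁, h₃, rfl, rfl, rfl⟩, h₄,
      (Fin.append_assoc _ _ _).symm, (CWProp.eq_of_cwEq (.par_assoc _ _ _)).symm,
      (Fin.append_assoc _ _ _).symm⟩

theorem id0_par {n m : ℕ} (F : Beh R X n m) :
    castH (Nat.zero_add n) (Nat.zero_add m) (CWOps.par CWOps.id0 F) = F := by
  have e : ∀ {k : ℕ} (u : Fin 0 → A) (w : Fin k → A),
      Fin.append u w ∘ Fin.cast (Nat.zero_add k).symm = w := by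
    intro k u w
    rw [Fin.append_left_nil u w rfl]; rfl
  refine ext_tr fun a c b => ?_
  rw [par_tr_castH]
  constructor
  · rintro ⟨a₁, c₁, b₁, a₂, c₂, b₂, h₁, h₂, rfl, rfl, rfl⟩
    obtain rfl := (id0_tr _ _ _).1 h₁
    rw [e, e, CWProp.eq_of_cwEq (.id0_par c₂)]; exact h₂
  · intro h
    exact ⟨![], _, ![], a, c, b, (id0_tr _ _ _).2 rfl, h, (e _ _).symm,
      (CWProp.eq_of_cwEq (.id0_par c)).symm, (e _ _).symm⟩

theorem par_id0 {n m : ℕ} (F : Beh R X n m) : CWOps.par F CWOps.id0 = F := by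
  have e : ∀ {k : ℕ} (u : Fin 0 → A) (w : Fin k → A), Fin.append w u = w := by
    intro k u w
    rw [Fin.append_right_nil w u rfl]; rfl
  refine ext_tr fun a c b => (par_tr F CWOps.id0 a c b).trans ?_
  constructor
  · rintro ⟨a₁, c₁, b₁, a₂, c₂, b₂, h₁, h₂, rfl, rfl, rfl⟩
    obtain rfl := (id0_tr _ _ _).1 h₂
    have hc : CWOps.par c₁ CWOps.id0 = c₁ := CWProp.eq_of_cwEq (.par_id0 c₁)
    rw [e, e, hc]; exact h₁
  · intro h
    exact ⟨a, c, b, ![], _, ![], h, (id0_tr _ _ _).2 rfl, (e _ _).symm,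
      (CWProp.eq_of_cwEq (.par_id0 c)).symm, (e _ _).symm⟩

theorem interchange {n₁ m₁ k₁ n₂ m₂ k₂ : ℕ} (F : Beh R X n₁ m₁) (G : Beh R X m₁ k₁)
    (H : Beh R X n₂ m₂) (I : Beh R X m₂ k₂) :
    CWOps.par (CWOps.seq F G) (CWOps.seq H I) = CWOps.seq (CWOps.par F H) (CWOps.par G I) := by
  refine ext_tr fun a c b => ?_
  simp only [par_tr, seq_tr]
  constructor
  · rintro ⟨a₁, c₁, b₁, a₂, c₂, b₂, ⟨w, f, g, hf, hg, rfl⟩, ⟨w', h, i, hh, hi, rfl⟩,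
      rfl, rfl, rfl⟩
    exact ⟨_, _, _, ⟨_, _, _, _, _, _, hf, hh, rfl, rfl, rfl⟩,
      ⟨_, _, _, _, _, _, hg, hi, rfl, rfl, rfl⟩, CWProp.eq_of_cwEq (.interchange _ _ _ _)⟩
  · rintro ⟨w, _, _, ⟨a₁, c₁, b₁, a₂, c₂, b₂, hf, hh, rfl, rfl, rfl⟩,
      ⟨a₁', c₁', b₁', a₂', c₂', b₂', hg, hi, e, rfl, rfl⟩, rfl⟩
    obtain ⟨rfl, rfl⟩ := append_inj.1 e
    exact ⟨_, _, _, _, _, _, ⟨_, _, _, hf, hg, rfl⟩, ⟨_, _, _, hh, hi, rfl⟩, rfl,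
      (CWProp.eq_of_cwEq (.interchange _ _ _ _)).symm, rfl⟩

theorem seq_assoc {n m k l : ℕ} (F : Beh R X n m) (G : Beh R X m k) (H : Beh R X k l) :
    CWOps.seq (CWOps.seq F G) H = CWOps.seq F (CWOps.seq G H) := by
  refine ext_tr fun a c b => ?_
  simp only [seq_tr]
  constructor
  · rintro ⟨w, _, h, ⟨w', f, g, hf, hg, rfl⟩, hh, rfl⟩
    exact ⟨_, _, _, hf, ⟨_, _, _, hg, hh, rfl⟩, CWProp.eq_of_cwEq (.seq_assoc _ _ _)⟩
  · rintro ⟨w, f, _, hf, ⟨w', g, h, hg, hh, rfl⟩, rfl⟩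
    exact ⟨_, _, _, ⟨_, _, _, hf, hg, rfl⟩, hh, (CWProp.eq_of_cwEq (.seq_assoc _ _ _)).symm⟩

theorem seq_id {n m : ℕ} (F : Beh R X n m) : CWOps.seq F (CWOps.idn m) = F := by
  refine ext_tr fun a c b => ?_
  simp only [seq_tr, idn_tr]
  constructor
  · rintro ⟨w, f, _, hf, ⟨rfl, rfl⟩, rfl⟩
    rwa [CWProp.eq_of_cwEq (.seq_id f)]
  · intro h
    exact ⟨_, _, _, h, ⟨rfl, rfl⟩, (CWProp.eq_of_cwEq (.seq_id c)).symm⟩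

theorem id_seq {n m : ℕ} (F : Beh R X n m) : CWOps.seq (CWOps.idn n) F = F := by
  refine ext_tr fun a c b => ?_
  simp only [seq_tr, idn_tr]
  constructor
  · rintro ⟨w, _, f, ⟨rfl, rfl⟩, hf, rfl⟩
    rwa [CWProp.eq_of_cwEq (.id_seq f)]
  · intro h
    exact ⟨_, _, _, ⟨rfl, rfl⟩, h, (CWProp.eq_of_cwEq (.id_seq c)).symm⟩

theorem symOneN_nat {n m : ℕ} (F : Beh R X n m) :
    CWOps.seq (CWOps.symOneN n) (CWOps.par F CWOps.id1) =
      CWOps.seq (CWOps.par CWOps.id1 F) (CWOps.symOneN m) := by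
  refine ext_tr fun a c b => ?_
  simp only [seq_tr, par_tr, symOneN_tr, id1_tr]
  constructor
  · rintro ⟨_, _, _, ⟨k, w, rfl, rfl, rfl⟩, ⟨a₁, f, b₁, _, _, _, hf, ⟨l, rfl, rfl, rfl⟩,
      e, rfl, rfl⟩, rfl⟩
    obtain ⟨rfl, e'⟩ := append_inj.1 e
    obtain rfl : k = l := congrFun e' 0
    exact ⟨_, _, _, ⟨_, _, _, _, _, _, ⟨k, rfl, rfl, rfl⟩, hf, rfl, rfl, rfl⟩,
      ⟨k, _, rfl, rfl, rfl⟩, CWProp.eq_of_cwEq (.symOneN_nat f)⟩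
  · rintro ⟨_, _, _, ⟨_, _, _, a₂, f, b₂, ⟨k, rfl, rfl, rfl⟩, hf, rfl, rfl, rfl⟩,
      ⟨l, w, e, rfl, rfl⟩, rfl⟩
    obtain ⟨e, rfl⟩ := append_inj.1 e
    obtain rfl : k = l := congrFun e 0
    exact ⟨_, _, _, ⟨k, _, rfl, rfl, rfl⟩, ⟨_, _, _, _, _, _, hf, ⟨k, rfl, rfl, rfl⟩,
      rfl, rfl, rfl⟩, (CWProp.eq_of_cwEq (.symOneN_nat f)).symm⟩

theorem symNOne_nat {n m : ℕ} (F : Beh R X n m) :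
    CWOps.seq (CWOps.symNOne n) (CWOps.par CWOps.id1 F) =
      CWOps.seq (CWOps.par F CWOps.id1) (CWOps.symNOne m) := by
  refine ext_tr fun a c b => ?_
  simp only [seq_tr, par_tr, symNOne_tr, id1_tr]
  constructor
  · rintro ⟨_, _, _, ⟨k, w, rfl, rfl, rfl⟩, ⟨_, _, _, a₂, f, b₂, ⟨l, rfl, rfl, rfl⟩, hf,
      e, rfl, rfl⟩, rfl⟩
    obtain ⟨e, rfl⟩ := append_inj.1 e
    obtain rfl : k = l := congrFun e 0
    exact ⟨_, _, _, ⟨_, _, _, _, _, _, hf, ⟨k, rfl, rfl, rfl⟩, rfl, rfl, rfl⟩,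
      ⟨k, _, rfl, rfl, rfl⟩, CWProp.eq_of_cwEq (.symNOne_nat f)⟩
  · rintro ⟨_, _, _, ⟨a₁, f, b₁, _, _, _, hf, ⟨k, rfl, rfl, rfl⟩, rfl, rfl, rfl⟩,
      ⟨l, w, e, rfl, rfl⟩, rfl⟩
    obtain ⟨rfl, e'⟩ := append_inj.1 e
    obtain rfl : k = l := congrFun e' 0
    exact ⟨_, _, _, ⟨k, _, rfl, rfl, rfl⟩, ⟨_, _, _, _, _, _, ⟨k, rfl, rfl, rfl⟩, hf,
      rfl, rfl, rfl⟩, (CWProp.eq_of_cwEq (.symNOne_nat f)).symm⟩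

/-- Transitions of the parallel composition of two components of given small sorts. -/
theorem comul_id_tr (a : Fin 2 → A) (c : X 2 3) (b : Fin 3 → A) :
    (CWOps.par CWOps.comul CWOps.id1 : Beh R X 2 3).Tr a c b ↔
      ∃ y k l m, R.comul y k l ∧ a = ![y, m] ∧ c = CWOps.par CWOps.comul CWOps.id1 ∧
        b = ![k, l, m] := by
  refine (par_tr CWOps.comul CWOps.id1 a c b).trans ?_
  constructor
  · rintro ⟨_, _, _, _, _, _, h₁, h₂, rfl, rfl, rfl⟩
    obtain ⟨y, k, l, h, rfl, rfl, rfl⟩ := (comul_tr _ _ _).1 h₁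
    obtain ⟨m, rfl, rfl, rfl⟩ := (id1_tr _ _ _).1 h₂
    exact ⟨y, k, l, m, h, append_one_one _ _, rfl, append_two_one _ _ _⟩
  · rintro ⟨y, k, l, m, h, rfl, rfl, rfl⟩
    exact ⟨![y], _, ![k, l], ![m], _, ![m], (comul_tr _ _ _).2 ⟨y, k, l, h, rfl, rfl, rfl⟩,
      (id1_tr _ _ _).2 ⟨m, rfl, rfl, rfl⟩, (append_one_one _ _).symm, rfl,
      (append_two_one _ _ _).symm⟩

theorem id_comul_tr (a : Fin 2 → A) (c : X 2 3) (b : Fin 3 → A) :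
    (CWOps.par CWOps.id1 CWOps.comul : Beh R X 2 3).Tr a c b ↔
      ∃ y k l m, R.comul y k l ∧ a = ![m, y] ∧ c = CWOps.par CWOps.id1 CWOps.comul ∧
        b = ![m, k, l] := by
  refine (par_tr CWOps.id1 CWOps.comul a c b).trans ?_
  constructor
  · rintro ⟨_, _, _, _, _, _, h₂, h₁, rfl, rfl, rfl⟩
    obtain ⟨y, k, l, h, rfl, rfl, rfl⟩ := (comul_tr _ _ _).1 h₁
    obtain ⟨m, rfl, rfl, rfl⟩ := (id1_tr _ _ _).1 h₂
    exact ⟨y, k, l, m, h, append_one_one _ _, rfl, append_one_two _ _ _⟩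
  · rintro ⟨y, k, l, m, h, rfl, rfl, rfl⟩
    exact ⟨![m], _, ![m], ![y], _, ![k, l], (id1_tr _ _ _).2 ⟨m, rfl, rfl, rfl⟩,
      (comul_tr _ _ _).2 ⟨y, k, l, h, rfl, rfl, rfl⟩, (append_one_one _ _).symm, rfl,
      (append_one_two _ _ _).symm⟩

theorem mul_id_tr (a : Fin 3 → A) (c : X 3 2) (b : Fin 2 → A) :
    (CWOps.par CWOps.mul CWOps.id1 : Beh R X 3 2).Tr a c b ↔
      ∃ k l y m, R.mul k l y ∧ a = ![k, l, m] ∧ c = CWOps.par CWOps.mul CWOps.id1 ∧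
        b = ![y, m] := by
  refine (par_tr CWOps.mul CWOps.id1 a c b).trans ?_
  constructor
  · rintro ⟨_, _, _, _, _, _, h₁, h₂, rfl, rfl, rfl⟩
    obtain ⟨k, l, y, h, rfl, rfl, rfl⟩ := (mul_tr _ _ _).1 h₁
    obtain ⟨m, rfl, rfl, rfl⟩ := (id1_tr _ _ _).1 h₂
    exact ⟨k, l, y, m, h, append_two_one _ _ _, rfl, append_one_one _ _⟩
  · rintro ⟨k, l, y, m, h, rfl, rfl, rfl⟩
    exact ⟨![k, l], _, ![y], ![m], _, ![m], (mul_tr _ _ _).2 ⟨k, l, y, h, rfl, rfl, rfl⟩,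
      (id1_tr _ _ _).2 ⟨m, rfl, rfl, rfl⟩, (append_two_one _ _ _).symm, rfl,
      (append_one_one _ _).symm⟩

theorem id_mul_tr (a : Fin 3 → A) (c : X 3 2) (b : Fin 2 → A) :
    (CWOps.par CWOps.id1 CWOps.mul : Beh R X 3 2).Tr a c b ↔
      ∃ k l y m, R.mul k l y ∧ a = ![m, k, l] ∧ c = CWOps.par CWOps.id1 CWOps.mul ∧
        b = ![m, y] := by
  refine (par_tr CWOps.id1 CWOps.mul a c b).trans ?_
  constructor
  · rintro ⟨_, _, _, _, _, _, h₂, h₁, rfl, rfl, rfl⟩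
    obtain ⟨k, l, y, h, rfl, rfl, rfl⟩ := (mul_tr _ _ _).1 h₁
    obtain ⟨m, rfl, rfl, rfl⟩ := (id1_tr _ _ _).1 h₂
    exact ⟨k, l, y, m, h, append_one_two _ _ _, rfl, append_one_one _ _⟩
  · rintro ⟨k, l, y, m, h, rfl, rfl, rfl⟩
    exact ⟨![m], _, ![m], ![k, l], _, ![y], (id1_tr _ _ _).2 ⟨m, rfl, rfl, rfl⟩,
      (mul_tr _ _ _).2 ⟨k, l, y, h, rfl, rfl, rfl⟩, (append_one_two _ _ _).symm, rfl,
      (append_one_one _ _).symm⟩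

theorem counit_id_tr (a : Fin 2 → A) (c : X 2 1) (b : Fin 1 → A) :
    (CWOps.par CWOps.counit CWOps.id1 : Beh R X 2 1).Tr a c b ↔
      ∃ y m, R.counit y ∧ a = ![y, m] ∧ c = CWOps.par CWOps.counit CWOps.id1 ∧ b = ![m] := by
  refine (par_tr CWOps.counit CWOps.id1 a c b).trans ?_
  constructor
  · rintro ⟨_, _, _, _, _, _, h₁, h₂, rfl, rfl, rfl⟩
    obtain ⟨y, h, rfl, rfl⟩ := (counit_tr _ _ _).1 h₁
    obtain ⟨m, rfl, rfl, rfl⟩ := (id1_tr _ _ _).1 h₂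
    exact ⟨y, m, h, append_one_one _ _, rfl, append_zero_one _ _⟩
  · rintro ⟨y, m, h, rfl, rfl, rfl⟩
    exact ⟨![y], _, ![], ![m], _, ![m], (counit_tr _ _ _).2 ⟨y, h, rfl, rfl⟩,
      (id1_tr _ _ _).2 ⟨m, rfl, rfl, rfl⟩, (append_one_one _ _).symm, rfl,
      (append_zero_one _ _).symm⟩

theorem unit_id_tr (a : Fin 1 → A) (c : X 1 2) (b : Fin 2 → A) :
    (CWOps.par CWOps.unit CWOps.id1 : Beh R X 1 2).Tr a c b ↔
      ∃ y m, R.unit y ∧ a = ![m] ∧ c = CWOps.par CWOps.unit CWOps.id1 ∧ b = ![y, m] := by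
  refine (par_tr CWOps.unit CWOps.id1 a c b).trans ?_
  constructor
  · rintro ⟨_, _, _, _, _, _, h₁, h₂, rfl, rfl, rfl⟩
    obtain ⟨y, h, rfl, rfl⟩ := (unit_tr _ _ _).1 h₁
    obtain ⟨m, rfl, rfl, rfl⟩ := (id1_tr _ _ _).1 h₂
    exact ⟨y, m, h, append_zero_one _ _, rfl, append_one_one _ _⟩
  · rintro ⟨y, m, h, rfl, rfl, rfl⟩
    exact ⟨![], _, ![y], ![m], _, ![m], (unit_tr _ _ _).2 ⟨y, h, rfl, rfl⟩,
      (id1_tr _ _ _).2 ⟨m, rfl, rfl, rfl⟩, (append_zero_one _ _).symm, rfl,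
      (append_one_one _ _).symm⟩

theorem vec1 {x y : A} : ![x] = ![y] ↔ x = y := by simp
theorem vec2 {x y x' y' : A} : ![x, y] = ![x', y'] ↔ x = x' ∧ y = y' := by simp
theorem vec3 {x y z x' y' z' : A} : ![x, y, z] = ![x', y', z'] ↔ x = x' ∧ y = y' ∧ z = z' := by
  simp

/-- Behaviours over a CW prop form a CW prop. -/
instance cwProp : CWProp (Beh R X) where
  eq_of_cwEq := by
    intro n m x y h
    cases h with
    | par_assoc f g h => exact par_assoc f g h
    | id0_par => exact id0_par y
    | par_id0 f => exact par_id0 f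
    | sym_sym =>
      refine ext_tr fun a c b => ?_
      simp only [seq_tr, idn_tr, sym_tr]
      have hX : CWOps.seq CWOps.sym CWOps.sym = (CWOps.idn 2 : X 2 2) :=
        CWProp.eq_of_cwEq .sym_sym
      constructor
      · rintro ⟨_, _, _, ⟨k, l, rfl, rfl, rfl⟩, ⟨k', l', e, rfl, rfl⟩, rfl⟩
        obtain ⟨rfl, rfl⟩ := vec2.1 e
        exact ⟨hX, rfl⟩
      · rintro ⟨rfl, rfl⟩
        have ha : a = ![a 0, a 1] := by funext i; fin_cases i <;> rfl
        exact ⟨_, _, _, ⟨a 0, a 1, ha, rfl, rfl⟩, ⟨a 1, a 0, rfl, rfl, ha⟩, hX.symm⟩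
    | interchange f g h i => exact interchange f g h i
    | seq_assoc f g h => exact seq_assoc f g h
    | seq_id => exact seq_id y
    | id_seq => exact id_seq y
    | symOneN_nat f => exact symOneN_nat f
    | symNOne_nat f => exact symNOne_nat f
    | comul_assoc =>
      refine ext_tr fun a c b => ?_
      simp only [seq_tr, comul_tr, comul_id_tr, id_comul_tr]
      have hX := CWProp.eq_of_cwEq (CWEq.comul_assoc (X := X))
      constructor
      · rintro ⟨_, _, _, ⟨x, y, m, h₁, rfl, rfl, rfl⟩, ⟨y', k, l, m', h₂, e, rfl, rfl⟩, rfl⟩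
        obtain ⟨rfl, rfl⟩ := vec2.1 e
        obtain ⟨y, h₁, h₂⟩ := (R.comul_assoc x k l m).1 ⟨y, h₁, h₂⟩
        exact ⟨_, _, _, ⟨x, k, y, h₁, rfl, rfl, rfl⟩, ⟨y, l, m, k, h₂, rfl, rfl, rfl⟩, hX⟩
      · rintro ⟨_, _, _, ⟨x, k, y, h₁, rfl, rfl, rfl⟩, ⟨y', l, m, k', h₂, e, rfl, rfl⟩, rfl⟩
        obtain ⟨rfl, rfl⟩ := vec2.1 e
        obtain ⟨y, h₁, h₂⟩ := (R.comul_assoc x k l m).2 ⟨y, h₁, h₂⟩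
        exact ⟨_, _, _, ⟨x, y, m, h₁, rfl, rfl, rfl⟩, ⟨y, k, l, m, h₂, rfl, rfl, rfl⟩, hX.symm⟩
    | comul_comm =>
      refine ext_tr fun a c b => ?_
      simp only [seq_tr, comul_tr, sym_tr]
      have hX := CWProp.eq_of_cwEq (CWEq.comul_comm (X := X))
      constructor
      · rintro ⟨_, _, _, ⟨x, k, l, h₁, rfl, rfl, rfl⟩, ⟨k', l', e, rfl, rfl⟩, rfl⟩
        obtain ⟨rfl, rfl⟩ := vec2.1 e
        exact ⟨x, l, k, (R.comul_comm _ _ _).1 h₁, rfl, hX, rfl⟩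
      · rintro ⟨x, k, l, h₁, rfl, rfl, rfl⟩
        exact ⟨_, _, _, ⟨x, l, k, (R.comul_comm _ _ _).1 h₁, rfl, rfl, rfl⟩,
          ⟨l, k, rfl, rfl, rfl⟩, hX.symm⟩
    | counit_comul =>
      refine ext_tr fun a c b => ?_
      simp only [seq_tr, comul_tr, counit_id_tr, id1_tr]
      have hX := CWProp.eq_of_cwEq (CWEq.counit_comul (X := X))
      constructor
      · rintro ⟨_, _, _, ⟨x, y, k, h₁, rfl, rfl, rfl⟩, ⟨y', k', h₂, e, rfl, rfl⟩, rfl⟩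
        obtain ⟨rfl, rfl⟩ := vec2.1 e
        obtain rfl := (R.counit_comul x k).1 ⟨y, h₁, h₂⟩
        exact ⟨x, rfl, hX, rfl⟩
      · rintro ⟨x, rfl, rfl, rfl⟩
        obtain ⟨y, h₁, h₂⟩ := (R.counit_comul x x).2 rfl
        exact ⟨_, _, _, ⟨x, y, x, h₁, rfl, rfl, rfl⟩, ⟨y, x, h₂, rfl, rfl, rfl⟩, hX.symm⟩
    | mul_assoc =>
      refine ext_tr fun a c b => ?_
      simp only [seq_tr, mul_tr, mul_id_tr, id_mul_tr]
      have hX := CWProp.eq_of_cwEq (CWEq.mul_assoc (X := X))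
      constructor
      · rintro ⟨_, _, _, ⟨k, l, y, m, h₁, rfl, rfl, rfl⟩, ⟨y', m', x, h₂, e, rfl, rfl⟩, rfl⟩
        obtain ⟨rfl, rfl⟩ := vec2.1 e
        obtain ⟨y, h₁, h₂⟩ := (R.mul_assoc x k l m).1 ⟨y, h₁, h₂⟩
        exact ⟨_, _, _, ⟨l, m, y, k, h₁, rfl, rfl, rfl⟩, ⟨k, y, x, h₂, rfl, rfl, rfl⟩, hX⟩
      · rintro ⟨_, _, _, ⟨l, m, y, k, h₁, rfl, rfl, rfl⟩, ⟨k', y', x, h₂, e, rfl, rfl⟩, rfl⟩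
        obtain ⟨rfl, rfl⟩ := vec2.1 e
        obtain ⟨y, h₁, h₂⟩ := (R.mul_assoc x k l m).2 ⟨y, h₁, h₂⟩
        exact ⟨_, _, _, ⟨k, l, y, m, h₁, rfl, rfl, rfl⟩, ⟨y, m, x, h₂, rfl, rfl, rfl⟩, hX.symm⟩
    | mul_comm =>
      refine ext_tr fun a c b => ?_
      simp only [seq_tr, mul_tr, sym_tr]
      have hX := CWProp.eq_of_cwEq (CWEq.mul_comm (X := X))
      constructor
      · rintro ⟨_, _, _, ⟨k, l, rfl, rfl, rfl⟩, ⟨k', l', x, h₁, e, rfl, rfl⟩, rfl⟩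
        obtain ⟨rfl, rfl⟩ := vec2.1 e
        exact ⟨k, l, x, (R.mul_comm _ _ _).1 h₁, rfl, hX, rfl⟩
      · rintro ⟨k, l, x, h₁, rfl, rfl, rfl⟩
        exact ⟨_, _, _, ⟨k, l, rfl, rfl, rfl⟩,
          ⟨l, k, x, (R.mul_comm _ _ _).1 h₁, rfl, rfl, rfl⟩, hX.symm⟩
    | unit_mul =>
      refine ext_tr fun a c b => ?_
      simp only [seq_tr, mul_tr, unit_id_tr, id1_tr]
      have hX := CWProp.eq_of_cwEq (CWEq.unit_mul (X := X))
      constructor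
      · rintro ⟨_, _, _, ⟨y, k, h₁, rfl, rfl, rfl⟩, ⟨y', k', x, h₂, e, rfl, rfl⟩, rfl⟩
        obtain ⟨rfl, rfl⟩ := vec2.1 e
        obtain rfl := (R.unit_mul x k).1 ⟨y, h₁, h₂⟩
        exact ⟨k, rfl, hX, rfl⟩
      · rintro ⟨x, rfl, rfl, rfl⟩
        obtain ⟨y, h₁, h₂⟩ := (R.unit_mul x x).2 rfl
        exact ⟨_, _, _, ⟨y, x, h₁, rfl, rfl, rfl⟩, ⟨y, x, x, h₂, rfl, rfl, rfl⟩, hX.symm⟩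
    | special =>
      refine ext_tr fun a c b => ?_
      simp only [seq_tr, mul_tr, comul_tr, id1_tr]
      have hX := CWProp.eq_of_cwEq (CWEq.special (X := X))
      constructor
      · rintro ⟨_, _, _, ⟨x, k, l, h₁, rfl, rfl, rfl⟩, ⟨k', l', y, h₂, e, rfl, rfl⟩, rfl⟩
        obtain ⟨rfl, rfl⟩ := vec2.1 e
        obtain rfl := (R.special x y).1 ⟨k, l, h₁, h₂⟩
        exact ⟨x, rfl, hX, rfl⟩
      · rintro ⟨x, rfl, rfl, rfl⟩
        obtain ⟨k, l, h₁, h₂⟩ := (R.special x x).2 rfl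
        exact ⟨_, _, _, ⟨x, k, l, h₁, rfl, rfl, rfl⟩, ⟨k, l, x, h₂, rfl, rfl, rfl⟩, hX.symm⟩
    | frobenius_left =>
      refine ext_tr fun a c b => ?_
      simp only [seq_tr, mul_tr, comul_tr, comul_id_tr, id_mul_tr]
      have hX := CWProp.eq_of_cwEq (CWEq.frobenius_left (X := X))
      constructor
      · rintro ⟨_, _, _, ⟨x, k, l, y, h₁, rfl, rfl, rfl⟩, ⟨l', y', z, k', h₂, e, rfl, rfl⟩, rfl⟩
        obtain ⟨rfl, rfl, rfl⟩ := vec3.1 e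
        obtain ⟨w, h₁, h₂⟩ := (R.frobenius_left x y k z).1 ⟨l, h₁, h₂⟩
        exact ⟨_, _, _, ⟨x, y, w, h₁, rfl, rfl, rfl⟩, ⟨w, k, z, h₂, rfl, rfl, rfl⟩, hX⟩
      · rintro ⟨_, _, _, ⟨x, y, w, h₁, rfl, rfl, rfl⟩, ⟨w', k, z, h₂, e, rfl, rfl⟩, rfl⟩
        obtain rfl := vec1.1 e
        obtain ⟨l, h₁, h₂⟩ := (R.frobenius_left x y k z).2 ⟨w, h₁, h₂⟩
        exact ⟨_, _, _, ⟨x, k, l, y, h₁, rfl, rfl, rfl⟩, ⟨l, y, z, k, h₂, rfl, rfl, rfl⟩,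
          hX.symm⟩
    | frobenius_right =>
      refine ext_tr fun a c b => ?_
      simp only [seq_tr, mul_tr, comul_tr, id_comul_tr, mul_id_tr]
      have hX := CWProp.eq_of_cwEq (CWEq.frobenius_right (X := X))
      constructor
      · rintro ⟨_, _, _, ⟨y, k, l, x, h₁, rfl, rfl, rfl⟩, ⟨x', k', z, l', h₂, e, rfl, rfl⟩, rfl⟩
        obtain ⟨rfl, rfl, rfl⟩ := vec3.1 e
        obtain ⟨w, h₁, h₂⟩ := (R.frobenius_right x y z l).1 ⟨k, h₁, h₂⟩
        exact ⟨_, _, _, ⟨x, y, w, h₁, rfl, rfl, rfl⟩, ⟨w, z, l, h₂, rfl, rfl, rfl⟩, hX⟩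
      · rintro ⟨_, _, _, ⟨x, y, w, h₁, rfl, rfl, rfl⟩, ⟨w', z, l, h₂, e, rfl, rfl⟩, rfl⟩
        obtain rfl := vec1.1 e
        obtain ⟨k, h₁, h₂⟩ := (R.frobenius_right x y z l).2 ⟨w, h₁, h₂⟩
        exact ⟨_, _, _, ⟨y, k, l, x, h₁, rfl, rfl, rfl⟩, ⟨x, k, z, l, h₂, rfl, rfl, rfl⟩,
          hX.symm⟩

end Beh

/-- The extension of `β`, a coalgebra on the generators whose transitions lead to string diagrams,
to all string diagrams, by means of the distributive law given by `R`: the only morphism of CW props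
from the free CW prop to behaviours over it that agrees with `β` on the generators. -/
def betaSharp {S : ℕ → ℕ → Type u} {A : Type v} (R : FrobLaw A)
    (β : ∀ n m : ℕ, S n m → Beh R (FreeCW S) n m) {n m : ℕ} (c : FreeCW S n m) :
    Beh R (FreeCW S) n m :=
  FreeCW.lift β c

/-! ## Diagrams built from the operations of CW props -/

namespace CWOps

variable {X : ℕ → ℕ → Type u} [CWOps X]

/-- The comultiplication on `n` wires: wire `i` on the left is joined to wires `i` and `n + i` on
the right. -/
def comulN : (n : ℕ) → X n (n + n)
  | 0 => id0
  | n + 1 =>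
    (seq (par (comulN n) comul : X (n + 1) (n + n + 2))
      (castH (show n + (n + 1) + 1 = n + n + 2 by omega)
        (show n + (1 + n) + 1 = n + 1 + (n + 1) by omega)
        (par (par (idn n) (symNOne n)) id1)) : X (n + 1) (n + 1 + (n + 1)))

/-- On `n + 1` wires (numbered from `0`), the diagram that exchanges wire `j` and the last wire
`n`. -/
def swapLast : (n : ℕ) → ℕ → X (n + 1) (n + 1)
  | 0, _ => id1
  | n + 1, j =>
    if j = n + 1 then idn (n + 2)
    else if j = n then (par (idn n) sym : X (n + 2) (n + 2))
    else seq (par (idn n) sym : X (n + 2) (n + 2))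
      (seq (par (swapLast n j) id1 : X (n + 1 + 1) (n + 1 + 1)) (par (idn n) sym : X (n + 2) (n + 2)))

/-- The permutation diagram on `n` wires given by a permutation `σ` of `ℕ` that fixes all `i ≥ n`:
wire `i` on the left is joined to wire `σ i` on the right. (With `τ` the transposition of `n` and
`σ n`, the permutation `τ * σ` fixes `n`, and `σ` is `τ * σ` followed by `τ`.) -/
def permN : (n : ℕ) → Equiv.Perm ℕ → X n n
  | 0, _ => id0
  | n + 1, σ => seq (par (permN n (Equiv.swap n (σ n) * σ)) id1) (swapLast n (σ n))

end CWOps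

/-! ## The process calculus

Names are indexed from `0`: the name `a_{i+1}` is the natural number `i`, so that
`{a_1, …, a_n}` is the set of all `i < n`. -/

/-- Finitely supported permutations of the set of names. -/
def FinPerm : Type := {σ : Equiv.Perm ℕ // {i | σ i ≠ i}.Finite}

/-- The degree of `σ`: the greatest `i` such that the name `a_i`, here `i - 1`, is in the support
of `σ`, and `0` if the support is empty. -/
noncomputable def FinPerm.degree (σ : FinPerm) : ℕ := σ.2.toFinset.sup fun i => i + 1

/-- Processes over a set `V` of process variables. -/
inductive Proc (V : Type u) : Type u
  | par (P Q : Proc V)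
  | nu (i : ℕ) (P : Proc V)
  | var (f : V)
  | perm (P : Proc V) (σ : FinPerm)

/-- The alphabet of a process. In a process `P σ` the name `i` plays the role that `σ i` plays
in `P`. -/
def Proc.al {V : Type u} (ar : V → ℕ) : Proc V → Set ℕ
  | .par P Q => P.al ar ∪ Q.al ar
  | .nu i P => P.al ar \ {i}
  | .var f => {i | i < ar f}
  | .perm P σ => σ.1 ⁻¹' P.al ar

/-- Typing derivations for the judgement `n ⊢ P`. -/
inductive Typed {V : Type u} (ar : V → ℕ) : ℕ → Proc V → Type u
  | par {n : ℕ} {P Q : Proc V} : Typed ar n P → Typed ar n Q → Typed ar n (.par P Q)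
  | nu {n : ℕ} {P : Proc V} : Typed ar (n + 1) P → Typed ar n (.nu n P)
  | var (f : V) : Typed ar (ar f) (.var f)
  | perm {n : ℕ} {P : Proc V} (σ : FinPerm) :
      Typed ar n P → σ.degree ≤ n → Typed ar n (.perm P σ)
  | weaken {n : ℕ} {P : Proc V} : Typed ar n P → Typed ar (n + 1) P

/-- The signature with one symbol of sort `(ar f, 0)` for each process variable `f`. -/
inductive ProcSig {V : Type u} (ar : V → ℕ) : ℕ → ℕ → Type u
  | var (f : V) : ProcSig ar (ar f) 0

/-- The string diagram of a typed process. -/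
def enc {V : Type u} {ar : V → ℕ} :
    ∀ {n : ℕ} {P : Proc V}, Typed ar n P → FreeCW (ProcSig ar) n 0
  | n, _, .par D E => CWOps.seq (CWOps.comulN n)
      (CWOps.par (enc D) (enc E) : FreeCW (ProcSig ar) (n + n) 0)
  | n, _, .nu D => CWOps.seq
      (CWOps.par (CWOps.idn n) CWOps.unit : FreeCW (ProcSig ar) n (n + 1)) (enc D)
  | _, _, .var f => FreeCW.gen (.var f)
  | n, _, .perm σ D _ => CWOps.seq (CWOps.permN n σ.1) (enc D)
  | n + 1, _, .weaken D => (CWOps.par (enc D) CWOps.counit : FreeCW (ProcSig ar) (n + 1) 0)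

/-- A declaration `f := ∑ i, α_i . P_i` of the process variable `f`, where actions are functions
from names to `M`. The actions and the processes have to be of the type of `f`. -/
structure Declaration {V : Type u} (M : Type v) [Zero M] (ar : V → ℕ) (f : V) where
  size : ℕ
  act : Fin size → ℕ → M
  cont : Fin size → Proc V
  act_al : ∀ i, Function.support (act i) ⊆ {j | j < ar f}
  cont_typed : ∀ i, Typed ar (ar f) (cont i)
  al_subset : {j | j < ar f} ⊆
    (⋃ i, Function.support (act i)) ∪ ⋃ i, (cont i).al ar

/-- Transitions of processes with Hoare synchronisation. Actions are functions from names to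
`2 = {0, 1}`, that is, sets of names; the union of `α` and `β` is `α ⊔ β`. -/
inductive HoareStep {V : Type u} {ar : V → ℕ} (decl : ∀ f, Declaration (Fin 2) ar f) :
    Proc V → (ℕ → Fin 2) → Proc V → Prop
  | idle (f : V) : HoareStep decl (.var f) 0 (.var f)
  | act (f : V) (i : Fin (decl f).size) :
      HoareStep decl (.var f) ((decl f).act i) ((decl f).cont i)
  | perm {P P' : Proc V} {α : ℕ → Fin 2} (σ : FinPerm) :
      HoareStep decl P α P' → HoareStep decl (.perm P σ) (α ∘ σ.1) (.perm P' σ)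
  | par {P P' Q Q' : Proc V} {α β : ℕ → Fin 2} :
      HoareStep decl P α P' → HoareStep decl Q β Q' →
      Function.support α ∩ Q.al ar = Function.support β ∩ P.al ar →
      HoareStep decl (.par P Q) (α ⊔ β) (.par P' Q')
  | nu {P P' : Proc V} {α : ℕ → Fin 2} (i : ℕ) :
      HoareStep decl P α P' → HoareStep decl (.nu i P) (Function.update α i 0) (.nu i P')

/-- Transitions of processes with Milner synchronisation. Actions are functions from names
to `ℤ`. -/
inductive MilnerStep {V : Type u} {ar : V → ℕ} (decl : ∀ f, Declaration ℤ ar f) :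
    Proc V → (ℕ → ℤ) → Proc V → Prop
  | idle (f : V) : MilnerStep decl (.var f) 0 (.var f)
  | act (f : V) (i : Fin (decl f).size) :
      MilnerStep decl (.var f) ((decl f).act i) ((decl f).cont i)
  | perm {P P' : Proc V} {α : ℕ → ℤ} (σ : FinPerm) :
      MilnerStep decl P α P' → MilnerStep decl (.perm P σ) (α ∘ σ.1) (.perm P' σ)
  | par {P P' Q Q' : Proc V} {α β : ℕ → ℤ} :
      MilnerStep decl P α P' → MilnerStep decl Q β Q' →
      MilnerStep decl (.par P Q) (α + β) (.par P' Q')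
  | nu {P P' : Proc V} {α : ℕ → ℤ} (i : ℕ) :
      MilnerStep decl P α P' → α i = 0 → MilnerStep decl (.nu i P) α (.nu i P')

/-- The word `n ⊢ α`: the restriction of the action `α` to the first `n` names. -/
def restrictAct {M : Type v} (n : ℕ) (α : ℕ → M) : Fin n → M := fun i => α i

/-- The coalgebra on the generators given by the declarations: a process variable `f` has the
transitions of its declaration, and a transition to itself with label `0`. -/
def declBeh {V : Type u} {M : Type v} [Zero M] {ar : V → ℕ} (R : FrobLaw M)
    (decl : ∀ f, Declaration M ar f) :
    ∀ n m : ℕ, ProcSig ar n m → Beh R (FreeCW (ProcSig ar)) n m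
  | _, _, .var f =>
    {x | (∃ i, x = (restrictAct (ar f) ((decl f).act i), enc ((decl f).cont_typed i), ![])) ∨
      x = (restrictAct (ar f) 0, FreeCW.gen (.var f), ![])}

/-- Transitions of string diagrams under the black distributive law, for declarations with actions
in `2`. -/
def BlackTrans {V : Type u} {ar : V → ℕ} (decl : ∀ f, Declaration (Fin 2) ar f) {n m : ℕ}
    (c : FreeCW (ProcSig ar) n m) (a : Fin n → Fin 2) (b : Fin m → Fin 2)
    (d : FreeCW (ProcSig ar) n m) : Prop :=
  (betaSharp (blackLaw (Fin 2)) (declBeh _ decl) c).Tr a d b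

/-- Transitions of string diagrams under the white distributive law, for declarations with actions
in `ℤ`. -/
def WhiteTrans {V : Type u} {ar : V → ℕ} (decl : ∀ f, Declaration ℤ ar f) {n m : ℕ}
    (c : FreeCW (ProcSig ar) n m) (a : Fin n → ℤ) (b : Fin m → ℤ)
    (d : FreeCW (ProcSig ar) n m) : Prop :=
  (betaSharp (whiteLaw ℤ) (declBeh _ decl) c).Tr a d b

/-! ## Morphisms and derived diagrams -/

namespace IsCWHom

variable {X : ℕ → ℕ → Type u} {Y : ℕ → ℕ → Type v} [CWOps X] [CWOps Y]
  {F : ∀ n m : ℕ, X n m → Y n m}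

/-! The extension `betaSharp` is a morphism of CW props, so a transition of `enc D` splits along the
clause of `enc` at the root of `D`. Once the label relations of the wirings are known
(`seqTr_comulN`, `seqTr_permN`), each clause becomes a condition on labels (`par_iff`, `nu_iff`,
`perm_iff`, `weaken_iff`, `var_iff`) that can be compared with the transition rules of processes.
Black copying hands one label to both components, which is Hoare's agreement on common names, and
the black unit accepts any label on the hidden wire, which is Hoare's erasure of the hidden name.
White copying splits a label into a sum, and the white unit demands `0`, as in Milner's rules.

Both directions are proved together by induction on the typing derivation (`black_iff_hoareStep`,
`white_iff_milnerStep`). The hypothesis that the action lives in the alphabet of `P` is not stable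
under this induction, since components have smaller alphabets. Under the black law the labels of
wires outside the alphabet are irrelevant, so there `α` is arbitrary and is cut down to the alphabet
on the process side. Under the white law a discarded wire carries `0`, and it suffices that `α`
vanishes from `n` on.

The other ingredient is `enc_unique`: the diagram depends on `n` and `P` only. It reconciles a given
derivation of the target of a step with the one that the induction builds. Derivations differ in the
places of their weakenings; these can be pushed through parallel compositions and permutations down
to a restriction or a variable, where their number is forced by `n`. -/

theorem comulN (hF : IsCWHom F) (n : ℕ) : F n (n + n) (CWOps.comulN n) = CWOps.comulN n := by
  induction n with
  | zero => exact hF.id0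
  | succ n ih =>
    refine (hF.seq _ _).trans (congrArg₂ CWOps.seq
      ((hF.par _ _).trans (congrArg₂ CWOps.par ih hF.comul)) ?_)
    rw [map_castH F, hF.par, hF.par, hF.idn, hF.symNOne, hF.id1]

theorem idn_sym (hF : IsCWHom F) (n : ℕ) :
    F (n + 2) (n + 2) (CWOps.par (CWOps.idn n) CWOps.sym) =
      CWOps.par (CWOps.idn n) CWOps.sym := by
  rw [hF.par, hF.idn, hF.sym]

theorem swapLast (hF : IsCWHom F) (n j : ℕ) :
    F (n + 1) (n + 1) (CWOps.swapLast n j) = CWOps.swapLast n j := by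
  induction n with
  | zero => exact hF.id1
  | succ n ih =>
    unfold CWOps.swapLast
    split_ifs
    · exact hF.idn _
    · exact hF.idn_sym n
    · rw [hF.seq, hF.seq, hF.idn_sym]
      exact congrArg₂ CWOps.seq rfl (congrArg₂ CWOps.seq
        ((hF.par _ _).trans (congrArg₂ CWOps.par ih hF.id1)) rfl)

theorem permN (hF : IsCWHom F) (n : ℕ) (σ : Equiv.Perm ℕ) :
    F n n (CWOps.permN n σ) = CWOps.permN n σ := by
  induction n generalizing σ with
  | zero => exact hF.id0
  | succ n ih =>
    exact (hF.seq _ _).trans (congrArg₂ CWOps.seq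
      ((hF.par _ _).trans (congrArg₂ CWOps.par (ih _) hF.id1)) (hF.swapLast n _))

end IsCWHom

/-! ## Transitions with labels given by sequences -/

namespace Beh

section

variable {A : Type v} {R : FrobLaw A} {X : ℕ → ℕ → Type u}

/-- The behaviour `F` has a transition to `c` whose labels are the initial segments of the
sequences `α` and `β`. -/
def SeqTr {n m : ℕ} (F : Beh R X n m) (α : ℕ → A) (c : X n m) (β : ℕ → A) : Prop :=
  F.Tr (restrictAct n α) c (restrictAct m β)

/-- Turns the word between two composed arrows into a sequence. The padding by `0` is never seen by
`restrictAct n`. With sequences, positions are natural numbers and no appended words or casts of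
`Fin` have to be compared. -/
theorem exists_restrictAct [Zero A] {n : ℕ} (a : Fin n → A) : ∃ α, restrictAct n α = a :=
  ⟨fun i => if h : i < n then a ⟨i, h⟩ else 0, funext fun i => by simp [restrictAct]⟩

theorem restrictAct_inj {n : ℕ} {α β : ℕ → A} :
    restrictAct n α = restrictAct n β ↔ ∀ i < n, α i = β i :=
  ⟨fun h i hi => congrFun h ⟨i, hi⟩, fun h => funext fun i => h i i.2⟩

theorem restrictAct_add (n m : ℕ) (α : ℕ → A) :
    restrictAct (n + m) α = Fin.append (restrictAct n α) (restrictAct m fun i => α (n + i)) := by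
  funext i
  refine Fin.addCases (fun i => ?_) (fun i => ?_) i <;> simp [restrictAct]

theorem restrictAct_zero (α : ℕ → A) : restrictAct 0 α = ![] := Subsingleton.elim _ _

theorem restrictAct_one (α : ℕ → A) : restrictAct 1 α = ![α 0] := by
  funext i; fin_cases i; rfl

theorem restrictAct_two (α : ℕ → A) : restrictAct 2 α = ![α 0, α 1] := by
  funext i; fin_cases i <;> rfl

/-- Sequences do not depend on the arities, so a transport affects the target only. -/
theorem seqTr_castH {n n' m m' : ℕ} (h : n = n') (h' : m = m') (F : Beh R X n m) (α : ℕ → A)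
    (c : X n' m') (β : ℕ → A) :
    SeqTr (castH h h' F : Beh R X n' m') α c β ↔ ∃ c', F.SeqTr α c' β ∧ c = castH h h' c' := by
  subst h h'
  exact ⟨fun h => ⟨c, h, rfl⟩, by rintro ⟨_, h, rfl⟩; exact h⟩

variable [CWOps X]

/-! ### Label relations of the operations and of the wirings -/

theorem seqTr_seq [Zero A] {n m k : ℕ} (F : Beh R X n m) (G : Beh R X m k) (α : ℕ → A)
    (c : X n k) (β : ℕ → A) :
    (CWOps.seq F G).SeqTr α c β ↔
      ∃ γ c₁ c₂, F.SeqTr α c₁ γ ∧ G.SeqTr γ c₂ β ∧ c = CWOps.seq c₁ c₂ := by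
  refine (seq_tr F G _ _ _).trans ⟨?_, ?_⟩
  · rintro ⟨w, c₁, c₂, h₁, h₂, rfl⟩
    obtain ⟨γ, rfl⟩ := exists_restrictAct w
    exact ⟨γ, c₁, c₂, h₁, h₂, rfl⟩
  · rintro ⟨γ, c₁, c₂, h₁, h₂, rfl⟩
    exact ⟨_, c₁, c₂, h₁, h₂, rfl⟩

theorem seqTr_par {n m n' m' : ℕ} (F : Beh R X n m) (G : Beh R X n' m') (α : ℕ → A)
    (c : X (n + n') (m + m')) (β : ℕ → A) :
    (CWOps.par F G).SeqTr α c β ↔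
      ∃ c₁ c₂, F.SeqTr α c₁ β ∧ G.SeqTr (fun i => α (n + i)) c₂ (fun i => β (m + i)) ∧
        c = CWOps.par c₁ c₂ := by
  unfold SeqTr
  rw [par_tr, restrictAct_add, restrictAct_add]
  constructor
  · rintro ⟨a₁, c₁, b₁, a₂, c₂, b₂, h₁, h₂, ha, rfl, hb⟩
    obtain ⟨rfl, rfl⟩ := append_inj.1 ha
    obtain ⟨rfl, rfl⟩ := append_inj.1 hb
    exact ⟨c₁, c₂, h₁, h₂, rfl⟩
  · rintro ⟨c₁, c₂, h₁, h₂, rfl⟩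
    exact ⟨_, c₁, _, _, c₂, _, h₁, h₂, rfl, rfl, rfl⟩

theorem seqTr_id0 (α : ℕ → A) (c : X 0 0) (β : ℕ → A) :
    (CWOps.id0 : Beh R X 0 0).SeqTr α c β ↔ c = CWOps.id0 := id0_tr _ _ _

theorem seqTr_id1 (α : ℕ → A) (c : X 1 1) (β : ℕ → A) :
    (CWOps.id1 : Beh R X 1 1).SeqTr α c β ↔ c = CWOps.id1 ∧ α 0 = β 0 := by
  simp only [SeqTr, id1_tr, restrictAct_one, vec1]
  grind

theorem seqTr_sym (α : ℕ → A) (c : X 2 2) (β : ℕ → A) :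
    (CWOps.sym : Beh R X 2 2).SeqTr α c β ↔ c = CWOps.sym ∧ α 0 = β 1 ∧ α 1 = β 0 := by
  simp only [SeqTr, sym_tr, restrictAct_two, vec2]
  grind

theorem seqTr_comul (α : ℕ → A) (c : X 1 2) (β : ℕ → A) :
    (CWOps.comul : Beh R X 1 2).SeqTr α c β ↔
      c = CWOps.comul ∧ R.comul (α 0) (β 0) (β 1) := by
  simp only [SeqTr, comul_tr, restrictAct_one, restrictAct_two, vec1, vec2]
  grind

theorem seqTr_counit (α : ℕ → A) (c : X 1 0) (β : ℕ → A) :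
    (CWOps.counit : Beh R X 1 0).SeqTr α c β ↔ c = CWOps.counit ∧ R.counit (α 0) := by
  simp only [SeqTr, counit_tr, restrictAct_one, vec1]
  grind

theorem seqTr_unit (α : ℕ → A) (c : X 0 1) (β : ℕ → A) :
    (CWOps.unit : Beh R X 0 1).SeqTr α c β ↔ c = CWOps.unit ∧ R.unit (β 0) := by
  simp only [SeqTr, unit_tr, restrictAct_one, vec1]
  grind

theorem seqTr_idn (n : ℕ) (α : ℕ → A) (c : X n n) (β : ℕ → A) :
    (CWOps.idn n : Beh R X n n).SeqTr α c β ↔ c = CWOps.idn n ∧ ∀ i < n, α i = β i := by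
  rw [SeqTr, idn_tr, restrictAct_inj]

theorem seqTr_par_id1 {n m : ℕ} (F : Beh R X n m) (α : ℕ → A) (c : X (n + 1) (m + 1))
    (β : ℕ → A) :
    (CWOps.par F CWOps.id1 : Beh R X (n + 1) (m + 1)).SeqTr α c β ↔
      ∃ c', F.SeqTr α c' β ∧ c = CWOps.par c' CWOps.id1 ∧ α n = β m := by
  rw [seqTr_par]
  simp only [seqTr_id1, add_zero]
  grind

theorem seqTr_idn_sym (n : ℕ) (α : ℕ → A) (c : X (n + 2) (n + 2)) (β : ℕ → A) :
    (CWOps.par (CWOps.idn n) CWOps.sym : Beh R X (n + 2) (n + 2)).SeqTr α c β ↔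
      c = CWOps.par (CWOps.idn n) CWOps.sym ∧
        (∀ i < n, α i = β i) ∧ α n = β (n + 1) ∧ α (n + 1) = β n := by
  rw [seqTr_par]
  simp only [seqTr_idn, seqTr_sym, add_zero]
  grind

theorem seqTr_symNOne (n : ℕ) (α : ℕ → A) (c : X (n + 1) (1 + n)) (β : ℕ → A) :
    (CWOps.symNOne n : Beh R X (n + 1) (1 + n)).SeqTr α c β ↔
      c = CWOps.symNOne n ∧ α n = β 0 ∧ ∀ i < n, α i = β (1 + i) := by
  unfold SeqTr
  rw [symNOne_tr, restrictAct_add, restrictAct_add]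
  simp only [restrictAct_one, append_inj, vec1]
  constructor
  · rintro ⟨k, w, ⟨h₁, h₂⟩, h₃, h₄, h₅⟩
    exact ⟨h₃, h₂.trans h₄.symm, restrictAct_inj.1 (h₁.trans h₅.symm)⟩
  · rintro ⟨h₁, h₂, h₃⟩
    exact ⟨_, _, ⟨rfl, rfl⟩, h₁, h₂.symm, (restrictAct_inj.2 h₃).symm⟩

/-- In the inductive step the first layer yields the two blocks of `n` copies followed by both
copies of the last wire; the second layer moves the first of these (position `n + n`) in front of
the second block (position `n`). -/
theorem seqTr_comulN [Zero A] (n : ℕ) (α : ℕ → A) (c : X n (n + n)) (β : ℕ → A) :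
    (CWOps.comulN n : Beh R X n (n + n)).SeqTr α c β ↔
      c = CWOps.comulN n ∧ ∀ i < n, R.comul (α i) (β i) (β (n + i)) := by
  induction n generalizing α β with
  | zero => exact (seqTr_id0 α c β).trans (by simp [CWOps.comulN])
  | succ n ih =>
    refine (seqTr_seq (CWOps.par (CWOps.comulN n) CWOps.comul : Beh R X (n + 1) (n + n + 2))
      _ α c β).trans ?_
    simp only [seqTr_castH, seqTr_par_id1]
    simp only [seqTr_par, ih, seqTr_comul, seqTr_idn, seqTr_symNOne]
    constructor
    · rintro ⟨γ, _, _, ⟨_, _, ⟨rfl, h₁⟩, ⟨rfl, h₂⟩, rfl⟩,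
        ⟨_, ⟨_, ⟨_, _, ⟨rfl, h₃⟩, ⟨rfl, h₄, h₅⟩, rfl⟩, rfl, h₆⟩, rfl⟩, rfl⟩
      refine ⟨rfl, fun i hi => ?_⟩
      obtain hi | rfl := Nat.lt_succ_iff_lt_or_eq.1 hi
      · have := h₁ i hi
        rw [h₃ i hi, h₅ i hi] at this
        rwa [Nat.add_assoc n 1 i]
      · simp only [add_zero] at h₂ h₄
        rwa [h₄, Nat.add_assoc, h₆, Nat.add_comm 1 i, ← Nat.add_assoc, Nat.add_right_comm] at h₂
    · rintro ⟨rfl, h⟩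
      -- The interior labels are `β` read through the routing layer: the second block is shifted by
      -- one, position `n + n` reads the output wire `n`, and all other positions are unchanged.
      refine ⟨fun i => if i < n then β i else if i < n + n then β (i + 1) else
          if i = n + n then β n else β i, _, _,
        ⟨_, _, ⟨rfl, fun i hi => ?_⟩, ⟨rfl, ?_⟩, rfl⟩,
        ⟨_, ⟨_, ⟨_, _, ⟨rfl, fun i hi => ?_⟩, ⟨rfl, ?_, fun i hi => ?_⟩, rfl⟩, rfl, ?_⟩,
          rfl⟩, rfl⟩
      · have := h i (by omega)
        rw [Nat.add_right_comm] at this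
        simpa [hi] using this
      · have := h n (by omega)
        rw [Nat.add_right_comm] at this
        simpa using this
      · simp [hi]
      · simp
      · simp [hi, Nat.add_comm 1 i, Nat.add_assoc]
      · have e : n + (1 + n) = n + n + 1 := by omega
        simp [e, ← Nat.add_assoc n n 1]

theorem seqTr_swapLast [Zero A] {n j : ℕ} (hj : j ≤ n) (α : ℕ → A) (c : X (n + 1) (n + 1))
    (β : ℕ → A) :
    (CWOps.swapLast n j : Beh R X (n + 1) (n + 1)).SeqTr α c β ↔
      c = CWOps.swapLast n j ∧ ∀ i ≤ n, α i = β (Equiv.swap n j i) := by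
  induction n generalizing α β with
  | zero =>
    obtain rfl : j = 0 := by omega
    refine (seqTr_id1 α c β).trans ?_
    simp [CWOps.swapLast]
  | succ n ih =>
    unfold CWOps.swapLast
    split_ifs with h₁ h₂
    · subst h₁
      rw [seqTr_idn]
      simp
    · subst h₂
      rw [seqTr_idn_sym]
      refine and_congr_right fun _ => ?_
      simp only [Equiv.swap_apply_def]
      grind
    · simp only [seqTr_seq, seqTr_idn_sym]
      -- For `j < n` the transposition of `n + 1` and `j` is that of `n` and `j` conjugated by that
      -- of `n` and `n + 1`, which is how the diagram is built.
      have hs : ∀ i, Equiv.swap (n + 1) j i =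
          Equiv.swap n (n + 1) (Equiv.swap n j (Equiv.swap n (n + 1) i)) := by
        intro i
        simp only [Equiv.swap_apply_def]
        grind
      constructor
      · rintro ⟨γ, _, _, ⟨rfl, h₃, h₄, h₅⟩, ⟨δ, _, _, h₆, ⟨rfl, h₇, h₈, h₉⟩, rfl⟩, rfl⟩
        obtain ⟨_, h, rfl, h₀⟩ := (seqTr_par_id1 _ _ _ _).1 h₆
        obtain ⟨rfl, h₆⟩ := (ih (by omega) _ _ _).1 h
        refine ⟨rfl, fun i hi => ?_⟩
        simp only [Equiv.swap_apply_def] at h₆ ⊢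
        grind
      · rintro ⟨rfl, h⟩
        -- The outer layers are adjacent transpositions, so the two interior words are `α` and `β`
        -- with the labels at `n` and `n + 1` exchanged.
        refine ⟨fun i => α (Equiv.swap n (n + 1) i), _, _, ⟨rfl, ?_, ?_, ?_⟩,
          ⟨fun i => β (Equiv.swap n (n + 1) i), _, _, (seqTr_par_id1 _ _ _ _).2
            ⟨_, (ih (by omega) _ _ _).2 ⟨rfl, ?_⟩, rfl, ?_⟩, ⟨rfl, ?_, ?_, ?_⟩, rfl⟩, rfl⟩
        all_goals simp only [hs, Equiv.swap_apply_def] at h ⊢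
        all_goals grind

theorem seqTr_permN [Zero A] {n : ℕ} {σ : Equiv.Perm ℕ} (hσ : ∀ i, n ≤ i → σ i = i) (α : ℕ → A)
    (c : X n n) (β : ℕ → A) :
    (CWOps.permN n σ : Beh R X n n).SeqTr α c β ↔
      c = CWOps.permN n σ ∧ ∀ i < n, α i = β (σ i) := by
  induction n generalizing σ α β with
  | zero => exact (seqTr_id0 α c β).trans (by simp [CWOps.permN])
  | succ n ih =>
    have hn : σ n ≤ n := by
      -- If `σ n` exceeded `n`, it would be a fixed point of `σ`, and injectivity would give `σ n =
      -- n`.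
      by_contra! h
      have := σ.injective (hσ (σ n) h)
      omega
    have hτ : ∀ i, n ≤ i → (Equiv.swap n (σ n) * σ) i = i := by
      intro i hi
      obtain rfl | hi := hi.eq_or_lt
      · simp
      · rw [Equiv.Perm.mul_apply, hσ i hi, Equiv.swap_apply_of_ne_of_ne] <;> omega
    unfold CWOps.permN
    simp only [seqTr_seq, seqTr_par_id1, ih hτ, seqTr_swapLast hn]
    constructor
    · rintro ⟨γ, _, _, ⟨_, ⟨rfl, h₁⟩, rfl, h₂⟩, ⟨rfl, h₃⟩, rfl⟩
      refine ⟨rfl, fun i hi => ?_⟩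
      have e : α i = γ (Equiv.swap n (σ n) (σ i)) := by
        obtain hi | rfl := Nat.lt_succ_iff_lt_or_eq.1 hi
        · exact h₁ i hi
        · simpa using h₂
      have hi' : σ i ≤ n := by
        by_contra! h
        have := σ.injective (hσ (σ i) h)
        omega
      rw [e, h₃, Equiv.swap_apply_self]
      rw [Equiv.swap_apply_def]
      split_ifs <;> omega
    · rintro ⟨rfl, h⟩
      -- The interior word is dictated by the second factor, whose transposition is its own inverse.
      refine ⟨fun i => β (Equiv.swap n (σ n) i), _, _, ⟨_, ⟨rfl, ?_⟩, rfl, ?_⟩, ⟨rfl, ?_⟩, rfl⟩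
      · intro i hi; simpa using h i (by omega)
      · simpa using h n (by omega)
      · intro i hi; rfl

end

end Beh

/-! ## Diagrams with discarded wires -/

namespace CWOps

theorem castH_heq {X : ℕ → ℕ → Type u} {n n' m m' : ℕ} (h : n = n') (h' : m = m') (x : X n m) :
    HEq (castH h h' x) x := by
  subst h h'; rfl

section

variable {X : ℕ → ℕ → Type u} [CWOps X]

/-- The arrow `c` on the first `n` of `n + k` wires, the others being discarded. -/
def discardN {n : ℕ} (c : X n 0) : (k : ℕ) → X (n + k) 0
  | 0 => c
  | k + 1 => (par (discardN c k) counit : X (n + k + 1) 0)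

/-- Associativity of `par` changes the arities by a propositional equality, so rebracketing below an
operation is carried out with `HEq`. -/
theorem par_heq_par {n₁ m₁ n₂ m₂ n₁' m₁' n₂' m₂' : ℕ} {f : X n₁ m₁} {g : X n₂ m₂}
    {f' : X n₁' m₁'} {g' : X n₂' m₂'} (h₁ : n₁ = n₁') (h₂ : m₁ = m₁') (h₃ : n₂ = n₂')
    (h₄ : m₂ = m₂') (hf : HEq f f') (hg : HEq g g') : HEq (par f g) (par f' g') := by
  subst h₁ h₂ h₃ h₄; rw [eq_of_heq hf, eq_of_heq hg]

theorem seq_heq_seq {n m k n' m' k' : ℕ} {f : X n m} {g : X m k} {f' : X n' m'} {g' : X m' k'}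
    (h₁ : n = n') (h₂ : m = m') (h₃ : k = k') (hf : HEq f f') (hg : HEq g g') :
    HEq (seq f g) (seq f' g') := by
  subst h₁ h₂ h₃; rw [eq_of_heq hf, eq_of_heq hg]

end

variable {X : ℕ → ℕ → Type u} [CWProp X]

theorem par_assoc_heq {n₁ m₁ n₂ m₂ n₃ m₃ : ℕ} (f : X n₁ m₁) (g : X n₂ m₂) (h : X n₃ m₃) :
    HEq (par (par f g) h) (par f (par g h)) :=
  (heq_of_eq (CWProp.eq_of_cwEq (.par_assoc f g h))).trans (castH_heq _ _ _)

/-! ### Consequences of the equations of CW props -/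

theorem seq_idn {n m : ℕ} (f : X n m) : seq f (idn m) = f := CWProp.eq_of_cwEq (.seq_id f)

theorem idn_seq {n m : ℕ} (f : X n m) : seq (idn n) f = f := CWProp.eq_of_cwEq (.id_seq f)

theorem seq_assoc {n m k l : ℕ} (f : X n m) (g : X m k) (h : X k l) :
    seq (seq f g) h = seq f (seq g h) := CWProp.eq_of_cwEq (.seq_assoc f g h)

theorem interchange {n₁ m₁ k₁ n₂ m₂ k₂ : ℕ} (f : X n₁ m₁) (g : X m₁ k₁) (h : X n₂ m₂)
    (i : X m₂ k₂) : par (seq f g) (seq h i) = seq (par f h) (par g i) :=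
  CWProp.eq_of_cwEq (.interchange f g h i)

theorem idn_one : (idn 1 : X 1 1) = id1 := CWProp.eq_of_cwEq (.id0_par id1)

theorem id1_seq {m : ℕ} (f : X 1 m) : seq id1 f = f := by rw [← idn_one, idn_seq]

theorem seq_id1 {n : ℕ} (f : X n 1) : seq f id1 = f := by rw [← idn_one, seq_idn]

theorem seq_id0 {n : ℕ} (f : X n 0) : seq f id0 = f := seq_idn f

/-- Discard the two copies one after the other: the first discarding cancels the copying by the
counit law. -/
theorem comul_counit_counit :
    seq comul (par counit counit : X 2 0) = (counit : X 1 0) := by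
  have h : (par counit counit : X 2 0) = seq (par counit id1 : X 2 1) counit := by
    have h' := interchange (counit : X 1 0) id0 id1 (counit : X 1 0)
    rw [seq_id0, id1_seq] at h'
    rw [h']
    exact congrArg (seq (par counit id1 : X 2 1)) (CWProp.eq_of_cwEq (.id0_par counit))
  rw [h, ← seq_assoc, CWProp.eq_of_cwEq .counit_comul, id1_seq]

/-- Naturality slides `e` through the symmetry, which then has no wires left to pass and is the
identity on one wire. -/
theorem symNOne_counit {n : ℕ} (e : X n 0) :
    (seq (symNOne n) (par counit e) : X (n + 1) 0) = par e counit := by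
  have h₁ := interchange (id1 : X 1 1) counit e id0
  rw [id1_seq, seq_id0] at h₁
  have h₂ := interchange e id0 (id1 : X 1 1) counit
  rw [id1_seq, seq_id0] at h₂
  rw [h₁, h₂, ← seq_assoc, CWProp.eq_of_cwEq (.symNOne_nat e)]
  refine congrArg₂ seq (seq_id1 _) ?_
  exact (CWProp.eq_of_cwEq (.par_id0 (counit : X 1 0))).trans
    (CWProp.eq_of_cwEq (.id0_par (counit : X 1 0))).symm

/-- Copying commutes with discarding the last wire. -/
theorem comulN_succ_counit {n : ℕ} (d e : X n 0) :
    seq (comulN (n + 1)) (par (par d counit : X (n + 1) 0) (par e counit : X (n + 1) 0)) =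
      (par (seq (comulN n) (par d e : X (n + n) 0)) counit : X (n + 1) 0) := by
  -- The routing layer of `comulN (n + 1)` carries the input of `e` past the counit next to `d`, so
  -- that both counits end up side by side behind `d` and `e`. There they meet the two copies of the
  -- last wire, and `comul_counit_counit` applies.
  have key : HEq
      (seq (castH (show n + (n + 1) + 1 = n + n + 2 by omega)
        (show n + (1 + n) + 1 = n + 1 + (n + 1) by omega)
        (par (par (idn n) (symNOne n)) id1))
        (par (par d counit : X (n + 1) 0) (par e counit : X (n + 1) 0)) : X (n + n + 2) 0)
      (par (par d e : X (n + n) 0) (par counit counit : X 2 0) : X (n + n + 2) 0) := by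
    have h₁ : HEq (par (par d counit : X (n + 1) 0) (par e counit : X (n + 1) 0))
        (par (par d (par counit e : X (1 + n) 0)) counit : X (n + (1 + n) + 1) 0) := by
      refine (par_assoc_heq d (counit : X 1 0) (par e counit : X (n + 1) 0)).trans ?_
      refine HEq.trans ?_ (par_assoc_heq d (par counit e : X (1 + n) 0) (counit : X 1 0)).symm
      exact par_heq_par rfl rfl (by omega) rfl HEq.rfl (par_assoc_heq _ _ _).symm
    refine (seq_heq_seq (by omega) (by omega) rfl (castH_heq _ _ _) h₁).trans ?_
    have h₂ : (seq (par (par (idn n) (symNOne n)) id1)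
        (par (par d (par counit e : X (1 + n) 0)) counit) : X (n + (n + 1) + 1) 0) =
        par (par d (par e counit : X (n + 1) 0)) counit := by
      refine (interchange _ _ _ _).symm.trans ?_
      rw [id1_seq]
      refine congrArg₂ par ((interchange _ _ _ _).symm.trans ?_) rfl
      rw [idn_seq]
      exact congrArg₂ par rfl (symNOne_counit e)
    refine (heq_of_eq h₂).trans ((par_assoc_heq _ _ _).trans ?_)
    refine HEq.trans ?_ (par_assoc_heq _ _ _).symm
    exact par_heq_par rfl rfl (by omega) rfl HEq.rfl (par_assoc_heq _ _ _)
  refine (seq_assoc _ _ _).trans ((congrArg (seq _) (eq_of_heq key)).trans ?_)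
  refine (interchange _ _ _ _).symm.trans ?_
  rw [comul_counit_counit]

theorem swapLast_self (n : ℕ) : (swapLast n n : X (n + 1) (n + 1)) = idn (n + 1) := by
  cases n with
  | zero => exact idn_one.symm
  | succ n => simp [swapLast]

/-- The exchange layer is the identity when `σ` fixes `n`. This lets a weakening pass through a
permutation of smaller degree. -/
theorem permN_succ {n : ℕ} {σ : Equiv.Perm ℕ} (h : σ n = n) :
    (permN (n + 1) σ : X (n + 1) (n + 1)) = par (permN n σ) id1 := by
  simp only [permN, h, swapLast_self, Equiv.swap_self]
  exact seq_idn _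

end CWOps

/-! ## Typing -/

/-- The degree counts names from one, so the bound `n` says that no index from `n` on is moved. -/
theorem FinPerm.degree_le {σ : FinPerm} {n : ℕ} : σ.degree ≤ n ↔ ∀ i, n ≤ i → σ.1 i = i := by
  simp only [FinPerm.degree, Finset.sup_le_iff, Set.Finite.mem_toFinset, Set.mem_ofPred_eq]
  exact ⟨fun h i hi => by_contra fun h' => absurd (h i h') (by omega),
    fun h i hi => by by_contra h'; exact hi (h i (by omega))⟩

namespace Typed

variable {V : Type u} {ar : V → ℕ}

theorem al_subset {n : ℕ} {P : Proc V} (D : Typed ar n P) : ∀ i ∈ P.al ar, i < n := by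
  induction D with
  | par _ _ ih₁ ih₂ => rintro i (hi | hi); exacts [ih₁ i hi, ih₂ i hi]
  | nu _ ih =>
    rintro i ⟨hi, hi'⟩
    have := ih i hi
    have : i ≠ _ := hi'
    omega
  | var f => exact fun i hi => hi
  | @perm n P σ _ hσ ih =>
    intro i hi
    by_contra! h
    have := ih _ hi
    rw [FinPerm.degree_le.1 hσ i h] at this
    omega
  | weaken _ ih => exact fun i hi => (ih i hi).trans (Nat.lt_succ_self _)

/-- Any derivation here ends in the parallel rule followed by weakenings, and `comulN_succ_counit`
moves each weakening into both components. -/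
theorem enc_eq_enc_par {P Q : Proc V} : ∀ {n : ℕ} (D : Typed ar n (.par P Q)),
    ∃ (D₁ : Typed ar n P) (D₂ : Typed ar n Q), enc D = enc (.par D₁ D₂)
  | _, .par D₁ D₂ => ⟨D₁, D₂, rfl⟩
  | n + 1, .weaken D => by
    obtain ⟨D₁, D₂, h⟩ := enc_eq_enc_par D
    refine ⟨D₁.weaken, D₂.weaken, ?_⟩
    simp only [enc, h]
    exact (CWOps.comulN_succ_counit _ _).symm

/-- The new wire `n` lies beyond the degree of `σ`, so the permutation is the identity on it and the
counit slides through. -/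
theorem enc_eq_enc_perm {P : Proc V} {σ : FinPerm} : ∀ {n : ℕ} (D : Typed ar n (.perm P σ)),
    ∃ (D₁ : Typed ar n P) (h : σ.degree ≤ n), enc D = enc (.perm σ D₁ h)
  | _, .perm _ D h => ⟨D, h, rfl⟩
  | n + 1, .weaken D => by
    obtain ⟨D₁, hσ, h⟩ := enc_eq_enc_perm D
    refine ⟨D₁.weaken, hσ.trans (Nat.le_succ _), ?_⟩
    simp only [enc, h, CWOps.permN_succ (FinPerm.degree_le.1 hσ n le_rfl)]
    have e := CWOps.interchange (CWOps.permN n σ.1) (enc D₁) CWOps.id1 CWOps.counit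
    rw [CWOps.id1_seq] at e
    exact e

/-- The restriction rule binds the last name only, so it can fire only at level `i`. The weakenings
below it cannot be moved inside, but their number `k` is determined by `i` and `n`. -/
theorem enc_eq_discardN_nu {P : Proc V} :
    ∀ {i n : ℕ} (D : Typed ar n (.nu i P)), ∃ (k : ℕ) (h : i + k = n) (D₁ : Typed ar (i + 1) P),
      enc D = castH h rfl (CWOps.discardN (enc (.nu D₁)) k)
  | _, _, .nu D => ⟨0, rfl, D, rfl⟩
  | _, n + 1, .weaken D => by
    obtain ⟨k, rfl, D₁, h⟩ := enc_eq_discardN_nu D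
    exact ⟨k + 1, rfl, D₁, by simp only [enc, h]; rfl⟩

/-- The process is kept as a variable `P` with an equation so that the induction on the derivation
applies. -/
theorem enc_eq_discardN_var {f : V} {n : ℕ} {P : Proc V} (hP : P = .var f) (D : Typed ar n P) :
    ∃ (k : ℕ) (h : ar f + k = n), enc D = castH h rfl (CWOps.discardN (enc (.var f)) k) := by
  induction D with
  | var => cases hP; exact ⟨0, rfl, rfl⟩
  | weaken D ih =>
    obtain ⟨k, rfl, h⟩ := ih hP
    exact ⟨k + 1, rfl, by simp only [enc, h]; rfl⟩
  | _ => cases hP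

/-- The diagram of a process does not depend on the typing derivation. -/
theorem enc_unique {P : Proc V} {n : ℕ} (D D' : Typed ar n P) : enc D = enc D' := by
  induction P generalizing n with
  | par P Q ihP ihQ =>
    obtain ⟨D₁, D₂, h⟩ := enc_eq_enc_par D
    obtain ⟨D₁', D₂', h'⟩ := enc_eq_enc_par D'
    rw [h, h']
    simp only [enc, ihP D₁ D₁', ihQ D₂ D₂']
  | nu i P ih =>
    obtain ⟨k, rfl, D₁, h⟩ := enc_eq_discardN_nu D
    obtain ⟨k', hk, D₁', h'⟩ := enc_eq_discardN_nu D'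
    obtain rfl : k' = k := by omega
    rw [h, h']
    simp only [enc, ih D₁ D₁']
  | var f =>
    obtain ⟨k, rfl, h⟩ := enc_eq_discardN_var rfl D
    obtain ⟨k', hk, h'⟩ := enc_eq_discardN_var rfl D'
    obtain rfl : k' = k := by omega
    rw [h, h']
  | perm P σ ih =>
    obtain ⟨D₁, _, h⟩ := enc_eq_enc_perm D
    obtain ⟨D₁', _, h'⟩ := enc_eq_enc_perm D'
    rw [h, h']
    simp only [enc, ih D₁ D₁']

end Typed

/-! ## Steps of processes -/

section

variable {V : Type u} {ar : V → ℕ}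

theorem HoareStep.support_subset {decl : ∀ f, Declaration (Fin 2) ar f} {P P' : Proc V}
    {α : ℕ → Fin 2} (h : HoareStep decl P α P') : Function.support α ⊆ P.al ar := by
  induction h with
  | idle f => simp
  | act f i => exact (decl f).act_al i
  | perm σ _ ih => exact fun i hi => ih hi
  | @par P P' Q Q' α β _ _ _ ih₁ ih₂ =>
    intro i hi
    by_contra h
    have h₁ : α i = 0 := Function.notMem_support.1 fun h' => h (.inl (ih₁ h'))
    have h₂ : β i = 0 := Function.notMem_support.1 fun h' => h (.inr (ih₂ h'))
    exact hi (by simp [h₁, h₂])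
  | nu i _ ih =>
    intro j hj
    by_cases hji : j = i
    · simp [hji] at hj
    · exact ⟨ih (by simpa [hji] using hj), hji⟩

theorem MilnerStep.support_subset {decl : ∀ f, Declaration ℤ ar f} {P P' : Proc V}
    {α : ℕ → ℤ} (h : MilnerStep decl P α P') : Function.support α ⊆ P.al ar := by
  induction h with
  | idle f => simp
  | act f i => exact (decl f).act_al i
  | perm σ _ ih => exact fun i hi => ih hi
  | @par P P' Q Q' α β _ _ ih₁ ih₂ =>
    intro i hi
    by_contra h
    have h₁ : α i = 0 := Function.notMem_support.1 fun h' => h (.inl (ih₁ h'))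
    have h₂ : β i = 0 := Function.notMem_support.1 fun h' => h (.inr (ih₂ h'))
    exact hi (by simp [h₁, h₂])
  | nu i _ hi ih => exact fun j hj => ⟨ih hj, by rintro rfl; exact hj hi⟩

/-- Induction on the derivation rather than on the step: a weakening leaves the process, and hence
the step, as it is. Only at a variable can the form of the term change, and there the declaration
provides the typing. -/
theorem HoareStep.typed {decl : ∀ f, Declaration (Fin 2) ar f} {n : ℕ} {P P' : Proc V}
    {α : ℕ → Fin 2} (D : Typed ar n P) (h : HoareStep decl P α P') :
    Nonempty (Typed ar n P') := by
  induction D generalizing P' α with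
  | par _ _ ih₁ ih₂ =>
    cases h with
    | par h₁ h₂ =>
      obtain ⟨D₁⟩ := ih₁ h₁
      obtain ⟨D₂⟩ := ih₂ h₂
      exact ⟨.par D₁ D₂⟩
  | nu _ ih =>
    cases h with
    | nu _ h => exact (ih h).map .nu
  | var f =>
    cases h with
    | idle => exact ⟨.var f⟩
    | act _ i => exact ⟨(decl f).cont_typed i⟩
  | perm σ _ hσ ih =>
    cases h with
    | perm _ h => exact (ih h).map fun D => .perm σ D hσ
  | weaken _ ih => exact (ih h).map .weaken

theorem MilnerStep.typed {decl : ∀ f, Declaration ℤ ar f} {n : ℕ} {P P' : Proc V}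
    {α : ℕ → ℤ} (D : Typed ar n P) (h : MilnerStep decl P α P') :
    Nonempty (Typed ar n P') := by
  induction D generalizing P' α with
  | par _ _ ih₁ ih₂ =>
    cases h with
    | par h₁ h₂ =>
      obtain ⟨D₁⟩ := ih₁ h₁
      obtain ⟨D₂⟩ := ih₂ h₂
      exact ⟨.par D₁ D₂⟩
  | nu _ ih =>
    cases h with
    | nu _ h => exact (ih h).map .nu
  | var f =>
    cases h with
    | idle => exact ⟨.var f⟩
    | act _ i => exact ⟨(decl f).cont_typed i⟩
  | perm σ _ hσ ih =>
    cases h with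
    | perm _ h => exact (ih h).map fun D => .perm σ D hσ
  | weaken _ ih => exact (ih h).map .weaken

/-! ## Transitions of the diagrams of processes -/

/-- The diagram `c : n → 0` has a transition to `d` labelled by the first `n` values of `α`. -/
def ActTrans {M : Type v} [Zero M] (R : FrobLaw M) (decl : ∀ f, Declaration M ar f) {n : ℕ}
    (c : FreeCW (ProcSig ar) n 0) (α : ℕ → M) (d : FreeCW (ProcSig ar) n 0) : Prop :=
  (betaSharp R (declBeh R decl) c).Tr (restrictAct n α) d ![]

namespace ActTrans

variable {M : Type v} [Zero M] {R : FrobLaw M} {decl : ∀ f, Declaration M ar f}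

/-- The right word is empty, so `β` is a free parameter, to be chosen as the decomposition of a
composite requires. -/
theorem iff_seqTr {n : ℕ} {c : FreeCW (ProcSig ar) n 0} {α : ℕ → M}
    {d : FreeCW (ProcSig ar) n 0} (β : ℕ → M) :
    ActTrans R decl c α d ↔ (betaSharp R (declBeh R decl) c).SeqTr α d β := by
  rw [ActTrans, Beh.SeqTr, Beh.restrictAct_zero]

theorem par_iff {n : ℕ} {P Q : Proc V} {D : Typed ar n P} {E : Typed ar n Q} {α : ℕ → M}
    {d : FreeCW (ProcSig ar) n 0} :
    ActTrans R decl (enc (.par D E)) α d ↔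
      ∃ β γ d₁ d₂, (∀ i < n, R.comul (α i) (β i) (γ i)) ∧ ActTrans R decl (enc D) β d₁ ∧
        ActTrans R decl (enc E) γ d₂ ∧
        d = CWOps.seq (CWOps.comulN n) (CWOps.par d₁ d₂ : FreeCW (ProcSig ar) (n + n) 0) := by
  have H := FreeCW.lift_isCWHom (declBeh R decl)
  have e : betaSharp R (declBeh R decl) (enc (.par D E)) = CWOps.seq (CWOps.comulN n)
      (CWOps.par (betaSharp R (declBeh R decl) (enc D)) (betaSharp R (declBeh R decl) (enc E)) :
        Beh R (FreeCW (ProcSig ar)) (n + n) 0) :=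
    (H.seq _ _).trans (congrArg₂ CWOps.seq (H.comulN n) (H.par _ _))
  rw [iff_seqTr 0, e, Beh.seqTr_seq]
  constructor
  · rintro ⟨γ, _, _, h₁, h₂, rfl⟩
    obtain ⟨rfl, h⟩ := (Beh.seqTr_comulN _ _ _ _).1 h₁
    obtain ⟨d₁, d₂, h₃, h₄, rfl⟩ := (Beh.seqTr_par _ _ _ _ _).1 h₂
    exact ⟨_, _, d₁, d₂, h, (iff_seqTr _).2 h₃, (iff_seqTr _).2 h₄, rfl⟩
  · rintro ⟨β, γ, d₁, d₂, h₁, h₂, h₃, rfl⟩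
    -- The interior word of length `n + n` is the concatenation of `β` and `γ`.
    refine ⟨fun i => if i < n then β i else γ (i - n), _, _, (Beh.seqTr_comulN _ _ _ _).2
      ⟨rfl, fun i hi => by simpa [hi] using h₁ i hi⟩, (Beh.seqTr_par _ _ _ _ _).2
        ⟨d₁, d₂, ?_, ?_, rfl⟩, rfl⟩
    · rw [← iff_seqTr, ActTrans, Beh.restrictAct_inj.2]
      · exact h₂
      · intro i hi; simp [hi]
    · rw [← iff_seqTr]
      simpa using h₃

/-- The hidden wire is interior to the composite, so its label `y` is quantified existentially; the
laws differ only in what `R.unit` lets it be. -/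
theorem nu_iff {n : ℕ} {P : Proc V} {D : Typed ar (n + 1) P} {α : ℕ → M}
    {d : FreeCW (ProcSig ar) n 0} :
    ActTrans R decl (enc (.nu D)) α d ↔
      ∃ y d', R.unit y ∧ ActTrans R decl (enc D) (Function.update α n y) d' ∧
        d = CWOps.seq
          (CWOps.par (CWOps.idn n) CWOps.unit : FreeCW (ProcSig ar) n (n + 1)) d' := by
  have H := FreeCW.lift_isCWHom (declBeh R decl)
  have e : betaSharp R (declBeh R decl) (enc (.nu D)) = CWOps.seq
      (CWOps.par (CWOps.idn n) CWOps.unit : Beh R (FreeCW (ProcSig ar)) n (n + 1))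
      (betaSharp R (declBeh R decl) (enc D)) :=
    (H.seq _ _).trans (congrArg₂ CWOps.seq
      ((H.par _ _).trans (congrArg₂ CWOps.par (H.idn n) H.unit)) rfl)
  rw [iff_seqTr 0, e, Beh.seqTr_seq]
  constructor
  · rintro ⟨γ, _, d', h₁, h₂, rfl⟩
    obtain ⟨_, _, h₃, h₄, rfl⟩ := (Beh.seqTr_par _ _ _ _ _).1 h₁
    obtain ⟨rfl, h₅⟩ := (Beh.seqTr_idn _ _ _ _).1 h₃
    obtain ⟨rfl, h₆⟩ := (Beh.seqTr_unit _ _ _).1 h₄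
    refine ⟨_, d', h₆, ?_, rfl⟩
    rw [← iff_seqTr, ActTrans] at h₂
    rw [ActTrans, Beh.restrictAct_inj.2]
    · exact h₂
    · intro i hi
      obtain hi | rfl := Nat.lt_succ_iff_lt_or_eq.1 hi
      · rw [Function.update_of_ne hi.ne, h₅ i hi]
      · simp
  · rintro ⟨y, d', h₁, h₂, rfl⟩
    exact ⟨_, _, d', (Beh.seqTr_par _ _ _ _ _).2 ⟨_, _, (Beh.seqTr_idn _ _ _ _).2
      ⟨rfl, fun i hi => (Function.update_of_ne hi.ne _ _).symm⟩,
      (Beh.seqTr_unit _ _ _).2 ⟨rfl, by simpa using h₁⟩, rfl⟩, (iff_seqTr _).1 h₂, rfl⟩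

/-- Wire `i` on the left continues as wire `σ i`, so `P` sees the label of the preimage under `σ`.
-/
theorem perm_iff {n : ℕ} {P : Proc V} {σ : FinPerm} {D : Typed ar n P} {hσ : σ.degree ≤ n}
    {α : ℕ → M} {d : FreeCW (ProcSig ar) n 0} :
    ActTrans R decl (enc (.perm σ D hσ)) α d ↔
      ∃ d', ActTrans R decl (enc D) (α ∘ σ.1.symm) d' ∧
        d = CWOps.seq (CWOps.permN n σ.1) d' := by
  have H := FreeCW.lift_isCWHom (declBeh R decl)
  have e : betaSharp R (declBeh R decl) (enc (.perm σ D hσ)) = CWOps.seq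
      (CWOps.permN n σ.1 : Beh R (FreeCW (ProcSig ar)) n n)
      (betaSharp R (declBeh R decl) (enc D)) :=
    (H.seq _ _).trans (congrArg₂ CWOps.seq (H.permN n σ.1) rfl)
  have hσ' := FinPerm.degree_le.1 hσ
  rw [iff_seqTr 0, e, Beh.seqTr_seq]
  simp only [Beh.seqTr_permN hσ']
  constructor
  · rintro ⟨γ, _, d', ⟨rfl, h₁⟩, h₂, rfl⟩
    refine ⟨d', ?_, rfl⟩
    rw [← iff_seqTr, ActTrans] at h₂
    rw [ActTrans, Beh.restrictAct_inj.2]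
    · exact h₂
    · intro i hi
      -- A preimage from `n` on would be fixed by `σ` and so equal to `i`, which is below `n`.
      have hi' : σ.1.symm i < n := by
        by_contra! h
        have := hσ' _ h
        rw [Equiv.apply_symm_apply] at this
        omega
      simpa using h₁ _ hi'
  · rintro ⟨d', h, rfl⟩
    exact ⟨_, _, d', ⟨rfl, fun i _ => by simp⟩, (iff_seqTr _).1 h, rfl⟩

theorem weaken_iff {n : ℕ} {P : Proc V} {D : Typed ar n P} {α : ℕ → M}
    {d : FreeCW (ProcSig ar) (n + 1) 0} :
    ActTrans R decl (enc (.weaken D)) α d ↔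
      ∃ d', R.counit (α n) ∧ ActTrans R decl (enc D) α d' ∧
        d = (CWOps.par d' CWOps.counit : FreeCW (ProcSig ar) (n + 1) 0) := by
  have H := FreeCW.lift_isCWHom (declBeh R decl)
  have e : betaSharp R (declBeh R decl) (enc (.weaken D)) =
      (CWOps.par (betaSharp R (declBeh R decl) (enc D)) CWOps.counit :
        Beh R (FreeCW (ProcSig ar)) (n + 1) 0) :=
    (H.par _ _).trans (congrArg₂ CWOps.par rfl H.counit)
  rw [iff_seqTr 0, e]
  refine (Beh.seqTr_par _ _ _ _ _).trans ?_
  simp only [Beh.seqTr_counit, ← iff_seqTr, add_zero]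
  constructor
  · rintro ⟨d', _, h₁, ⟨rfl, h₂⟩, rfl⟩
    exact ⟨d', h₂, h₁, rfl⟩
  · rintro ⟨d', h₂, h₁, rfl⟩
    exact ⟨d', _, h₁, ⟨rfl, h₂⟩, rfl⟩

theorem var_iff {f : V} {α : ℕ → M} {d : FreeCW (ProcSig ar) (ar f) 0} :
    ActTrans R decl (enc (.var f)) α d ↔
      (∃ i, (∀ j < ar f, α j = (decl f).act i j) ∧ d = enc ((decl f).cont_typed i)) ∨
        (∀ j < ar f, α j = 0) ∧ d = enc (.var f) := by
  change ((∃ i, (restrictAct (ar f) α, d, ![]) = _) ∨ (restrictAct (ar f) α, d, ![]) = _) ↔ _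
  simp only [Prod.mk.injEq, Beh.restrictAct_inj, and_true]
  rfl

end ActTrans

/-! ### The two correspondences, by induction on the typing derivation -/

open Classical in
/-- A diagram moves under the black law as its process does under Hoare synchronisation. -/
theorem black_iff_hoareStep {decl : ∀ f, Declaration (Fin 2) ar f} {n : ℕ} {P : Proc V}
    (D : Typed ar n P) (α : ℕ → Fin 2) (d : FreeCW (ProcSig ar) n 0) :
    ActTrans (blackLaw (Fin 2)) decl (enc D) α d ↔
      ∃ (P' : Proc V) (D' : Typed ar n P'),
        HoareStep decl P ((P.al ar).indicator α) P' ∧ enc D' = d := by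
  induction D generalizing α with
  | @par n P Q D E ihD ihE =>
    simp only [ActTrans.par_iff, ihD, ihE]
    constructor
    · rintro ⟨β, γ, _, _, h, ⟨P', D', hP, rfl⟩, ⟨Q', E', hQ, rfl⟩, rfl⟩
      refine ⟨.par P' Q', .par D' E', ?_, rfl⟩
      -- Black copying makes `β` and `γ` agree with `α` on the first `n` wires, and these include
      -- both alphabets.
      have hβ : (P.al ar).indicator β = (P.al ar).indicator α :=
        Set.indicator_congr fun i hi => (h i (D.al_subset i hi)).1
      have hγ : (Q.al ar).indicator γ = (Q.al ar).indicator α :=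
        Set.indicator_congr fun i hi => (h i (E.al_subset i hi)).2
      rw [hβ] at hP
      rw [hγ] at hQ
      have e : ((Proc.par P Q).al ar).indicator α =
          (P.al ar).indicator α ⊔ (Q.al ar).indicator α := by
        funext i
        by_cases h₁ : i ∈ P.al ar <;> by_cases h₂ : i ∈ Q.al ar <;>
          simp [Proc.al, Set.indicator, h₁, h₂]
      rw [e]
      refine .par hP hQ ?_
      -- Both sides of the synchronisation condition are the support of `α` cut down to the common
      -- alphabet.
      simp only [Set.support_indicator]
      ext i
      simp only [Set.mem_inter_iff]
      tauto
    · rintro ⟨R', D', h, rfl⟩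
      generalize hα : ((Proc.par P Q).al ar).indicator α = α' at h
      cases h with
      | @par _ P' _ Q' β γ hP hQ hs =>
        obtain ⟨D₁⟩ := hP.typed D
        obtain ⟨E₁⟩ := hQ.typed E
        have hβ := hP.support_subset
        have hγ := hQ.support_subset
        have key : ∀ i, i ∈ P.al ar ∨ i ∈ Q.al ar → α i = β i ⊔ γ i := by
          intro i hi
          have := congrFun hα i
          rwa [Set.indicator_of_mem (show i ∈ (Proc.par P Q).al ar from hi)] at this
        have hs' : ∀ i, (β i ≠ 0 ∧ i ∈ Q.al ar) ↔ (γ i ≠ 0 ∧ i ∈ P.al ar) :=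
          fun i => Set.ext_iff.1 hs i
        -- On common names the synchronisation condition says that `β` and `γ` vanish together; with
        -- only two labels this means that they are equal, hence equal to their join. Elsewhere at
        -- least one of them is `0`.
        have two : ∀ x y : Fin 2, (x ≠ 0 ↔ y ≠ 0) → x = x ⊔ y ∧ y = x ⊔ y := by decide
        have e₁ : (P.al ar).indicator α = β := by
          funext i
          by_cases hi : i ∈ P.al ar
          · rw [Set.indicator_of_mem hi, key i (.inl hi)]
            by_cases hi' : i ∈ Q.al ar
            · exact (two _ _ (by simpa [hi, hi'] using hs' i)).1.symm
            · have : γ i = 0 := Function.notMem_support.1 fun h => hi' (hγ h)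
              simp [this]
          · rw [Set.indicator_of_notMem hi]
            exact (Function.notMem_support.1 fun h => hi (hβ h)).symm
        have e₂ : (Q.al ar).indicator α = γ := by
          funext i
          by_cases hi : i ∈ Q.al ar
          · rw [Set.indicator_of_mem hi, key i (.inr hi)]
            by_cases hi' : i ∈ P.al ar
            · exact (two _ _ (by simpa [hi, hi'] using hs' i)).2.symm
            · have : β i = 0 := Function.notMem_support.1 fun h => hi' (hβ h)
              simp [this]
          · rw [Set.indicator_of_notMem hi]
            exact (Function.notMem_support.1 fun h => hi (hγ h)).symm
        -- Both copies carry `α` itself; the actions of the two components are its restrictions to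
        -- their alphabets.
        exact ⟨α, α, _, _, fun i _ => ⟨rfl, rfl⟩, ⟨P', D₁, e₁.symm ▸ hP, rfl⟩,
          ⟨Q', E₁, e₂.symm ▸ hQ, rfl⟩, D'.enc_unique (.par D₁ E₁)⟩
  | @nu n P D ih =>
    simp only [ActTrans.nu_iff, ih]
    constructor
    · rintro ⟨y, _, -, ⟨P', D', h, rfl⟩, rfl⟩
      refine ⟨.nu n P', .nu D', ?_, rfl⟩
      convert HoareStep.nu n h using 1
      funext i
      by_cases hi : i = n <;> by_cases hi' : i ∈ P.al ar <;>
        simp [Set.indicator, Proc.al, hi, hi']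
    · rintro ⟨_, D', h, rfl⟩
      generalize hα : ((Proc.nu n P).al ar).indicator α = α' at h
      cases h with
      | @nu _ P' β _ h =>
        obtain ⟨D₁⟩ := h.typed D
        -- The black unit allows any label, so the hidden wire is given the value that the
        -- restriction rule erased from `β`.
        refine ⟨β n, _, trivial, ⟨P', D₁, ?_, rfl⟩, D'.enc_unique (.nu D₁)⟩
        convert h using 1
        funext i
        by_cases hi : i ∈ P.al ar
        · rw [Set.indicator_of_mem hi]
          by_cases hin : i = n
          · simp [hin]
          · have := congrFun hα i
            rw [Set.indicator_of_mem (show i ∈ (Proc.nu n P).al ar from ⟨hi, hin⟩)] at this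
            simpa [hin] using this
        · rw [Set.indicator_of_notMem hi]
          exact (Function.notMem_support.1 fun h' => hi (h.support_subset h')).symm
  | var f =>
    have hal : ∀ β : ℕ → Fin 2, Function.support β ⊆ {j | j < ar f} →
        ((∀ j < ar f, α j = β j) ↔ ((Proc.var f).al ar).indicator α = β) := by
      intro β hβ
      refine ⟨fun h => ?_, fun h j hj => ?_⟩
      · rw [← Set.indicator_eq_self.2 hβ]
        exact Set.indicator_congr h
      · rw [← h, Set.indicator_of_mem (show j ∈ (Proc.var f).al ar from hj)]
    rw [ActTrans.var_iff]
    constructor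
    · rintro (⟨i, h, rfl⟩ | ⟨h, rfl⟩)
      · rw [(hal _ ((decl f).act_al i)).1 h]
        exact ⟨_, (decl f).cont_typed i, .act f i, rfl⟩
      · rw [(hal 0 (by simp)).1 h]
        exact ⟨_, .var f, .idle f, rfl⟩
    · rintro ⟨_, D', h, rfl⟩
      generalize hα : ((Proc.var f).al ar).indicator α = α' at h
      cases h with
      | idle => exact .inr ⟨(hal 0 (by simp)).2 hα, D'.enc_unique _⟩
      | act _ i => exact .inl ⟨i, (hal _ ((decl f).act_al i)).2 hα, D'.enc_unique _⟩
  | @perm n P σ D hσ ih =>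
    simp only [ActTrans.perm_iff, ih]
    have e : ∀ α : ℕ → Fin 2, ((Proc.perm P σ).al ar).indicator α =
        (P.al ar).indicator (α ∘ σ.1.symm) ∘ σ.1 := by
      intro α
      funext i
      simp [Set.indicator, Proc.al]
    constructor
    · rintro ⟨_, ⟨P', D', h, rfl⟩, rfl⟩
      refine ⟨.perm P' σ, .perm σ D' hσ, ?_, rfl⟩
      rw [e]
      exact .perm σ h
    · rintro ⟨_, D', h, rfl⟩
      generalize hα : ((Proc.perm P σ).al ar).indicator α = α' at h
      cases h with
      | @perm _ P' β _ h =>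
        obtain ⟨D₁⟩ := h.typed D
        rw [e, σ.1.surjective.right_cancellable] at hα
        exact ⟨_, ⟨P', D₁, hα.symm ▸ h, rfl⟩, D'.enc_unique (.perm σ D₁ hσ)⟩
  | @weaken n P D ih =>
    -- The black counit puts no condition on the new wire, and the restriction of `α` to the
    -- alphabet of `P` does not change with `n`.
    simp only [ActTrans.weaken_iff, ih]
    constructor
    · rintro ⟨_, -, ⟨P', D', h, rfl⟩, rfl⟩
      exact ⟨P', .weaken D', h, rfl⟩
    · rintro ⟨P', D', h, rfl⟩
      obtain ⟨D₁⟩ := h.typed D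
      exact ⟨_, trivial, ⟨P', D₁, h, rfl⟩, D'.enc_unique (.weaken D₁)⟩

/-- A diagram moves under the white law as its process does under Milner synchronisation. -/
theorem white_iff_milnerStep {decl : ∀ f, Declaration ℤ ar f} {n : ℕ} {P : Proc V}
    (D : Typed ar n P) {α : ℕ → ℤ} (hα : ∀ i, n ≤ i → α i = 0) (d : FreeCW (ProcSig ar) n 0) :
    ActTrans (whiteLaw ℤ) decl (enc D) α d ↔
      ∃ (P' : Proc V) (D' : Typed ar n P'), MilnerStep decl P α P' ∧ enc D' = d := by
  -- In the direction from steps to transitions, this supplies the vanishing hypothesis for the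
  -- actions of the components.
  have vanish : ∀ {n : ℕ} {P P' : Proc V} {β : ℕ → ℤ} (_ : Typed ar n P)
      (_ : MilnerStep decl P β P') (i : ℕ), n ≤ i → β i = 0 := by
    intro n P P' β D h i hi
    by_contra h'
    have := D.al_subset i (h.support_subset h')
    omega
  induction D generalizing α with
  | @par n P Q D E ihD ihE =>
    rw [ActTrans.par_iff]
    constructor
    · rintro ⟨β, γ, d₁, d₂, h, h₁, h₂, rfl⟩
      -- The sequences obtained from copying are uncontrolled from `n` on. Truncating them leaves
      -- the transitions unchanged and makes the induction hypotheses applicable.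
      have cut : ∀ β : ℕ → ℤ, restrictAct n β = restrictAct n fun i => if i < n then β i else 0 :=
        fun β => Beh.restrictAct_inj.2 fun i hi => by simp [hi]
      rw [ActTrans, cut, ← ActTrans] at h₁ h₂
      obtain ⟨P', D', hP, rfl⟩ := (ihD (fun i hi => by simp [hi]) _).1 h₁
      obtain ⟨Q', E', hQ, rfl⟩ := (ihE (fun i hi => by simp [hi]) _).1 h₂
      refine ⟨.par P' Q', .par D' E', ?_, rfl⟩
      convert MilnerStep.par hP hQ using 1
      -- Below `n` the white copying law is the required sum; from `n` on all three values are `0`.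
      funext i
      by_cases hi : i < n
      · simpa [hi] using (h i hi).symm
      · simpa [hi] using hα i (by omega)
    · rintro ⟨_, D', h, rfl⟩
      cases h with
      | @par _ P' _ Q' β γ hP hQ =>
        obtain ⟨D₁⟩ := hP.typed D
        obtain ⟨E₁⟩ := hQ.typed E
        exact ⟨β, γ, _, _, fun i _ => rfl, (ihD (vanish D hP) _).2 ⟨P', D₁, hP, rfl⟩,
          (ihE (vanish E hQ) _).2 ⟨Q', E₁, hQ, rfl⟩, D'.enc_unique (.par D₁ E₁)⟩
  | @nu n P D ih =>
    rw [ActTrans.nu_iff]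
    -- The white unit forces `0` on the hidden wire, the value that `α` already has there; the same
    -- fact is the side condition of Milner's restriction rule.
    have e : Function.update α n 0 = α := by
      rw [← hα n le_rfl, Function.update_eq_self]
    have ih' := fun d => ih (fun i (hi : n + 1 ≤ i) => hα i (by omega)) d
    constructor
    · rintro ⟨_, d', rfl, h, rfl⟩
      rw [e] at h
      obtain ⟨P', D', hP, rfl⟩ := (ih' _).1 h
      exact ⟨.nu n P', .nu D', .nu n hP (hα n le_rfl), rfl⟩
    · rintro ⟨_, D', h, rfl⟩
      cases h with
      | @nu _ P' _ _ h _ =>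
        obtain ⟨D₁⟩ := h.typed D
        exact ⟨0, _, rfl, e.symm ▸ (ih' _).2 ⟨P', D₁, h, rfl⟩, D'.enc_unique (.nu D₁)⟩
  | var f =>
    have hal : ∀ β : ℕ → ℤ, Function.support β ⊆ {j | j < ar f} →
        ((∀ j < ar f, α j = β j) ↔ α = β) := by
      intro β hβ
      refine ⟨fun h => funext fun i => ?_, fun h i _ => congrFun h i⟩
      by_cases hi : i < ar f
      · exact h i hi
      · rw [hα i (by omega)]
        exact (Function.notMem_support.1 fun h' => hi (hβ h')).symm
    rw [ActTrans.var_iff]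
    constructor
    · rintro (⟨i, h, rfl⟩ | ⟨h, rfl⟩)
      · rw [(hal _ ((decl f).act_al i)).1 h]
        exact ⟨_, (decl f).cont_typed i, .act f i, rfl⟩
      · rw [(hal 0 (by simp)).1 h]
        exact ⟨_, .var f, .idle f, rfl⟩
    · rintro ⟨_, D', h, rfl⟩
      cases h with
      | idle => exact .inr ⟨fun _ _ => rfl, D'.enc_unique _⟩
      | act _ i => exact .inl ⟨i, fun _ _ => rfl, D'.enc_unique _⟩
  | @perm n P σ D hσ ih =>
    have hσ' := FinPerm.degree_le.1 hσ
    have hα' : ∀ i, n ≤ i → (α ∘ σ.1.symm) i = 0 := by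
      intro i hi
      -- The inverse of `σ` fixes the same indices, so permuting keeps the labels from `n` on equal
      -- to `0`.
      rw [Function.comp_apply, (Equiv.symm_apply_eq _).2 (hσ' i hi).symm]
      exact hα i hi
    simp only [ActTrans.perm_iff, ih hα']
    constructor
    · rintro ⟨_, ⟨P', D', h, rfl⟩, rfl⟩
      refine ⟨.perm P' σ, .perm σ D' hσ, ?_, rfl⟩
      convert MilnerStep.perm σ h using 1
      funext i
      simp
    · rintro ⟨_, D', h, rfl⟩
      cases h with
      | @perm _ P' β _ h =>
        obtain ⟨D₁⟩ := h.typed D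
        refine ⟨_, ⟨P', D₁, ?_, rfl⟩, D'.enc_unique (.perm σ D₁ hσ)⟩
        convert h using 1
        funext i
        simp
  | @weaken n P D ih =>
    rw [ActTrans.weaken_iff]
    constructor
    · rintro ⟨d', h₀, h, rfl⟩
      -- The white counit gives `α n = 0`, which lowers the vanishing bound from `n + 1` to `n`.
      obtain ⟨P', D', hP, rfl⟩ := (ih (fun i hi => by
        obtain rfl | hi := hi.eq_or_lt
        exacts [h₀, hα i hi]) _).1 h
      exact ⟨P', .weaken D', hP, rfl⟩
    · rintro ⟨P', D', h, rfl⟩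
      obtain ⟨D₁⟩ := h.typed D
      exact ⟨_, vanish D h n le_rfl, (ih (vanish D h) _).2 ⟨P', D₁, h, rfl⟩,
        D'.enc_unique (.weaken D₁)⟩

end

/-- Hoare is black, Milner is white. The words `![]` are the empty right label `•`. -/
theorem mainTheorem1 {V : Type u} (ar : V → ℕ)
    (declH : ∀ f, Declaration (Fin 2) ar f) (declM : ∀ f, Declaration ℤ ar f)
    {n : ℕ} {P : Proc V} (D : Typed ar n P) :
    (∀ α : ℕ → Fin 2, Function.support α ⊆ P.al ar →
      (∀ P', HoareStep declH P α P' →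
        Nonempty (Typed ar n P') ∧
          ∀ D' : Typed ar n P', BlackTrans declH (enc D) (restrictAct n α) ![] (enc D')) ∧
      (∀ d, BlackTrans declH (enc D) (restrictAct n α) ![] d →
        ∃ (P' : Proc V) (D' : Typed ar n P'), HoareStep declH P α P' ∧ enc D' = d)) ∧
    (∀ α : ℕ → ℤ, Function.support α ⊆ P.al ar →
      (∀ P', MilnerStep declM P α P' →
        Nonempty (Typed ar n P') ∧
          ∀ D' : Typed ar n P', WhiteTrans declM (enc D) (restrictAct n α) ![] (enc D')) ∧
      (∀ d, WhiteTrans declM (enc D) (restrictAct n α) ![] d →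
        ∃ (P' : Proc V) (D' : Typed ar n P'), MilnerStep declM P α P' ∧ enc D' = d)) := by
  refine ⟨fun α hα => ?_, fun α hα => ?_⟩
  · have key := fun d => black_iff_hoareStep (decl := declH) D α d
    -- An action within the alphabet is not changed by cutting it down to the alphabet.
    simp only [Set.indicator_eq_self.2 hα] at key
    exact ⟨fun P' h => ⟨h.typed D, fun D' => (key _).2 ⟨P', D', h, rfl⟩⟩, fun d => (key d).1⟩
  · have key := fun d => white_iff_milnerStep (decl := declM) D (α := α)
      -- The alphabet of `P` lies below `n`, so an action supported in it vanishes from `n` on.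
      (fun i hi => by_contra fun h => absurd (D.al_subset i (hα h)) (by omega)) d
    exact ⟨fun P' h => ⟨h.typed D, fun D' => (key _).2 ⟨P', D', h, rfl⟩⟩, fun d => (key d).1⟩
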